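/- All categories are ordinary locally small categories (enrichment base $\mathcal V=\mathbf{Set}$). \textbf{Definitions.} A \emph{lex-weight} is a presheaf $\phi\colon\mathcal K^{\mathrm{op}}\to\mathbf{Set}$ on a small finitely complete category $\mathcal K$ ($\phi$ need not preserve finite limits). For a class $\Phi$ of lex-weights, a \emph{$\Phi$-lex-colimit} in a category $\mathcal E$ with finite limits is a weighted colimit $\phi\star D$ with $\phi\colon\mathcal K^{\mathrm{op}}\to\mathbf{Set}$ in $\Phi$ and $D\colon\mathcal K\to\mathcal E$ preserving finite limits. For a finitely complete category $\mathcal C$ let $\Phi\mathcal C$ be the smallest full replete subcategory of $[\mathcal C^{\mathrm{op}},\mathbf{Set}]$ that contains the representables and is closed under finite limits and $\Phi$-lex-colimits. The category $\mathcal C$ is \emph{$\Phi$-exact} if the restricted Yoneda embedding $W\colon\mathcal C\to\Phi\mathcal C$ has a left adjoint which preserves finite limits. Let $\Phi_\vee=\{\phi_0,\phi_2\}$, where $\phi_0$ is the initial (empty) presheaf on the terminal category, and where $\phi_2$ is the following presheaf on the free category with finite limits $\mathcal K_2$ generated by a pair of monomorphisms $A\rightarrowtail C\leftarrowtail B$: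 the union in $[\mathcal K_2^{\mathrm{op}},\mathbf{Set}]$ of the subobjects $\mathcal K_2(-,A)$ and $\mathcal K_2(-,B)$ of $\mathcal K_2(-,C)$. \textbf{Proposition.} For a finitely complete category $\mathcal C$ the following are equivalent: \begin{enumerate} \item $\mathcal C$ is $\Phi_\vee$-exact; \item $\mathcal C$ has a strict initial object, and for every pair of monomorphisms $A\rightarrowtail X\leftarrowtail B$ with pullback $A\cap B$, the span $A\leftarrow A\cap B\rightarrow B$ has a pushout, which is stable under pullback (the pullback of the pushout square along any morphism into its vertex is again a pushout square); \item every finite set of subobjects of an object of $\mathcal C$ has a union (a least upper bound in the poset of subobjects); these unions are stable under pullback along arbitrary morphisms; and binary unions are effective, that is, for any subobjects $A,B$ of an object $X$ the pullback square with vertices $A\cap B$, $A$, $B$, $A\cup B$ is also a pushout. \end{enumerate} -/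

import Mathlib

open CategoryTheory Limits Opposite

universe v u w w'

namespace LexColim

/-! ### Weighted colimits of `Set`-valued weights -/

section Weighted

variable {K : Type w} [Category.{w'} K] {E : Type u} [Category.{v} E]

/-- A cocone with vertex `X` under `D : K ⥤ E`, weighted by `φ : Kᵒᵖ ⥤ Type _`; that is, a natural
transformation `φ ⟶ E(D -, X)`, written out elementwise. -/
structure WeightedCocone (φ : Kᵒᵖ ⥤ Type w') (D : K ⥤ E) (X : E) where
  /-- the components of the transformation -/
  leg : ∀ k : K, φ.obj (op k) → (D.obj k ⟶ X)
  naturality : ∀ {k l : K} (f : k ⟶ l) (x : φ.obj (op l)),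
    leg k (φ.map f.op x) = D.map f ≫ leg l x

/-- A weighted cocone exhibits its vertex `X` as the weighted colimit `φ ⋆ D`: composition with it
is a bijection from `E(X, Y)` to the set of natural transformations `φ ⟶ E(D -, Y)`. -/
def WeightedCocone.IsColimit {φ : Kᵒᵖ ⥤ Type w'} {D : K ⥤ E} {X : E}
    (c : WeightedCocone φ D X) : Prop :=
  ∀ (Y : E) (s : WeightedCocone φ D Y),
    ∃! f : X ⟶ Y, ∀ (k : K) (x : φ.obj (op k)), c.leg k x ≫ f = s.leg k x

end Weighted

/-! ### Classes of lex-weights and exactness -/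

/-- A weight for lex colimits: a presheaf of sets on a small finitely complete category.
(The weight itself is not required to preserve finite limits.) -/
structure LexWeight where
  /-- the domain -/
  K : Type v
  [cat : SmallCategory K]
  [lex : HasFiniteLimits K]
  /-- the presheaf -/
  weight : Kᵒᵖ ⥤ Type v

attribute [instance] LexWeight.cat LexWeight.lex

/-- The closure of the representables in `[Cᵒᵖ, Set]` under isomorphism, finite limits and
`Φ`-lex-colimits, i.e. colimits `φ ⋆ D` with `φ : Kᵒᵖ ⥤ Set` in `Φ` and `D` a finite-limit
preserving functor from `K` to presheaves already in the closure. -/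
inductive InLexCompletion (Φ : Set LexWeight.{v}) (C : Type u) [Category.{v} C] :
    (Cᵒᵖ ⥤ Type v) → Prop
  | representable (X : C) : InLexCompletion Φ C (yoneda.obj X)
  | iso {F G : Cᵒᵖ ⥤ Type v} (e : F ≅ G) (hF : InLexCompletion Φ C F) : InLexCompletion Φ C G
  | finiteLimit {J : Type} [SmallCategory J] [FinCategory J] (F : J ⥤ Cᵒᵖ ⥤ Type v)
      (hF : ∀ j, InLexCompletion Φ C (F.obj j)) (c : Cone F) (hc : IsLimit c) :
      InLexCompletion Φ C c.pt
  | lexColimit (φ : LexWeight.{v}) (hφ : φ ∈ Φ) (D : φ.K ⥤ Cᵒᵖ ⥤ Type v)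
      (hD : PreservesFiniteLimits D) (hD' : ∀ k, InLexCompletion Φ C (D.obj k))
      (X : Cᵒᵖ ⥤ Type v) (c : WeightedCocone φ.weight D X) (hc : c.IsColimit) :
      InLexCompletion Φ C X

/-- The full subcategory `Φ C` of `[Cᵒᵖ, Set]`, as a property of presheaves. -/
def lexCompletion (Φ : Set LexWeight.{v}) (C : Type u) [Category.{v} C] :
    ObjectProperty (Cᵒᵖ ⥤ Type v) :=
  InLexCompletion Φ C

/-- The restricted Yoneda embedding `W : C ⥤ Φ C`. -/
def lexCompletionUnit (Φ : Set LexWeight.{v}) (C : Type u) [Category.{v} C] :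
    C ⥤ (lexCompletion Φ C).FullSubcategory :=
  (lexCompletion Φ C).lift yoneda fun X => InLexCompletion.representable X

/-- `Φ`-exactness of a finitely complete category: the unit `W : C ⥤ Φ C` has a left adjoint
which preserves finite limits. -/
def IsLexExact (Φ : Set LexWeight.{v}) (C : Type u) [Category.{v} C] [HasFiniteLimits C] : Prop :=
  ∃ L : (lexCompletion Φ C).FullSubcategory ⥤ C,
    Nonempty (L ⊣ lexCompletionUnit Φ C) ∧ PreservesFiniteLimits L

/-! ### The free category with finite limits on a pair of monomorphisms `A ↣ C ↢ B` -/

/-- Objects of the free category with finite limits on a pair of monomorphisms `A ↣ C ↢ B`.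
The object `(n, S, T)` is the subobject of the power `Cⁿ` consisting of the `x` with
`xᵢ ∈ A` for `i ∈ S` and `xᵢ ∈ B` for `i ∈ T`. -/
structure MonoPair : Type v where
  /-- the exponent -/
  n : ℕ
  /-- the coordinates required to lie in `A` -/
  S : Set (Fin n)
  /-- the coordinates required to lie in `B` -/
  T : Set (Fin n)

namespace MonoPair

/-- A morphism `(n, S, T) ⟶ (m, S', T')`: the map `x ↦ (x_{f j})_j` given by a reindexing
`f : Fin m → Fin n` which sends `S'` into `S` and `T'` into `T`. -/
@[ext]
structure Hom (X Y : MonoPair.{v}) : Type v where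
  /-- the reindexing -/
  idx : Fin Y.n → Fin X.n
  mapS : ∀ j ∈ Y.S, idx j ∈ X.S
  mapT : ∀ j ∈ Y.T, idx j ∈ X.T

instance : SmallCategory MonoPair.{v} where
  Hom := Hom
  id X := ⟨id, fun _ h => h, fun _ h => h⟩
  comp f g := ⟨f.idx ∘ g.idx, fun j h => f.mapS _ (g.mapS j h), fun j h => f.mapT _ (g.mapT j h)⟩

@[ext]
lemma hom_ext {X Y : MonoPair.{v}} {f g : X ⟶ Y} (h : ∀ j, f.idx j = g.idx j) : f = g :=
  Hom.ext (funext h)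

@[simp] lemma comp_idx {X Y Z : MonoPair.{v}} (f : X ⟶ Y) (g : Y ⟶ Z) (j : Fin Z.n) :
    (f ≫ g).idx j = f.idx (g.idx j) := rfl

@[simp] lemma id_idx (X : MonoPair.{v}) (j : Fin X.n) : Hom.idx (𝟙 X) j = j := rfl

/-- The generating object `C`. -/
def objC : MonoPair.{v} := ⟨1, ∅, ∅⟩

/-- The generating object `A`. -/
def objA : MonoPair.{v} := ⟨1, Set.univ, ∅⟩

/-- The generating object `B`. -/
def objB : MonoPair.{v} := ⟨1, ∅, Set.univ⟩

/-- The generating monomorphism `A ↣ C`. -/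
def inclA : objA.{v} ⟶ objC := ⟨id, fun _ h => h.elim, fun _ h => h⟩

/-- The generating monomorphism `B ↣ C`. -/
def inclB : objB.{v} ⟶ objC := ⟨id, fun _ h => h, fun _ h => h.elim⟩

section Limits

variable {J : Type} [SmallCategory J] [FinCategory J] (F : J ⥤ MonoPair.{v})

/-- The identifications between coordinates forced by a finite diagram. -/
inductive Rel : (Σ j, Fin (F.obj j).n) → (Σ j, Fin (F.obj j).n) → Prop
  | mk {i j : J} (f : i ⟶ j) (x : Fin (F.obj j).n) : Rel ⟨j, x⟩ ⟨i, (F.map f).idx x⟩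

lemma exists_coords : ∃ m : ℕ, Nonempty (Quot (Rel F) ≃ Fin m) :=
  have : Finite (Quot (Rel F)) := Quot.finite _
  let ⟨m, ⟨e⟩⟩ := Finite.exists_equiv_fin (Quot (Rel F))
  ⟨m, ⟨e⟩⟩

/-- A numbering of the coordinates of the limit. -/
noncomputable def coords : Quot (Rel F) ≃ Fin (exists_coords F).choose :=
  (exists_coords F).choose_spec.some

/-- The limit cone of a finite diagram. -/
noncomputable def limitCone : Cone F where
  pt :=
    { n := (exists_coords F).choose
      S := {i | ∃ j, ∃ x ∈ (F.obj j).S, coords F (Quot.mk _ ⟨j, x⟩) = i}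
      T := {i | ∃ j, ∃ x ∈ (F.obj j).T, coords F (Quot.mk _ ⟨j, x⟩) = i} }
  π :=
    { app j := ⟨fun x => coords F (Quot.mk _ ⟨j, x⟩), fun x hx => ⟨j, x, hx, rfl⟩,
        fun x hx => ⟨j, x, hx, rfl⟩⟩
      naturality i j f := by
        refine hom_ext fun x => ?_
        exact congrArg (coords F) (Quot.sound (Rel.mk f x)) }

/-- The universal property of `limitCone`. -/
noncomputable def limitConeIsLimit : IsLimit (limitCone F) where
  lift s :=
    have key : ∀ a b, Rel F a b → (s.π.app a.1).idx a.2 = (s.π.app b.1).idx b.2 := by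
      rintro _ _ ⟨f, x⟩
      exact congrArg (fun h => Hom.idx h x) (s.w f).symm
    { idx := fun i => Quot.lift (fun a => (s.π.app a.1).idx a.2) key ((coords F).symm i)
      mapS := by
        rintro _ ⟨j, x, hx, rfl⟩
        simpa using (s.π.app j).mapS x hx
      mapT := by
        rintro _ ⟨j, x, hx, rfl⟩
        simpa using (s.π.app j).mapT x hx }
  fac s j := by
    ext x
    simp [limitCone]
  uniq s m hm := by
    refine hom_ext fun i => ?_
    obtain ⟨q, rfl⟩ := (coords F).surjective i
    obtain ⟨⟨j, x⟩, rfl⟩ := Quot.exists_rep q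
    have := congrArg (fun h => Hom.idx h x) (hm j)
    rw [comp_idx] at this
    simpa [limitCone] using this

end Limits

instance : HasFiniteLimits MonoPair.{v} where
  out _ _ _ := ⟨fun F => ⟨⟨⟨limitCone F, limitConeIsLimit F⟩⟩⟩⟩

section Universal

variable {E : Type w} [Category.{w'} E]

/-- The `i`-th coordinate. -/
def ev (X : MonoPair.{v}) (i : Fin X.n) : X ⟶ objC.{v} :=
  ⟨fun _ => i, fun _ h => h.elim, fun _ h => h.elim⟩

lemma map_ev {X Y : MonoPair.{v}} (f : X ⟶ Y) (j : Fin Y.n) : f ≫ Y.ev j = X.ev (f.idx j) := rfl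

/-- The families in `E(T, C)ⁿ` which satisfy the membership conditions of `X = (n, S, T)`. -/
def Good {A B C : E} (a : A ⟶ C) (b : B ⟶ C) (X : MonoPair.{v}) {T : E}
    (x : Fin X.n → (T ⟶ C)) : Prop :=
  (∀ i ∈ X.S, ∃ t, t ≫ a = x i) ∧ (∀ i ∈ X.T, ∃ t, t ≫ b = x i)

lemma Good.precomp {A B C : E} {a : A ⟶ C} {b : B ⟶ C} {X : MonoPair.{v}} {T T' : E}
    {x : Fin X.n → (T ⟶ C)}
    (h : Good a b X x) (g : T' ⟶ T) : Good a b X (fun i => g ≫ x i) :=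
  ⟨fun i hi => let ⟨t, ht⟩ := h.1 i hi; ⟨g ≫ t, by simp [ht]⟩,
   fun i hi => let ⟨t, ht⟩ := h.2 i hi; ⟨g ≫ t, by simp [ht]⟩⟩

/-- `D`, with the projections `e`, is the subobject of `Cⁿ` described by `X`. -/
def Represents {A B C : E} (a : A ⟶ C) (b : B ⟶ C) (X : MonoPair.{v}) (D : E)
    (e : Fin X.n → (D ⟶ C)) : Prop :=
  Good a b X e ∧ ∀ (T : E) (x : Fin X.n → (T ⟶ C)), Good a b X x → ∃! f : T ⟶ D, ∀ i, f ≫ e i = x i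

lemma exists_rep [HasFiniteLimits E] {A B C : E} (a : A ⟶ C) (b : B ⟶ C) [Mono a] [Mono b]
    (X : MonoPair.{v}) :
    ∃ D e, Represents a b X D e := by
  classical
  have h1 : ∀ i : Fin X.n, ∃ (Z : E) (m : Z ⟶ C), Mono m ∧ ∀ (T : E) (x : T ⟶ C),
      (∃ t, t ≫ m = x) ↔ ((i ∈ X.S → ∃ t, t ≫ a = x) ∧ (i ∈ X.T → ∃ t, t ≫ b = x)) := by
    intro i
    by_cases hS : i ∈ X.S <;> by_cases hT : i ∈ X.T
    · refine ⟨pullback a b, pullback.fst a b ≫ a, inferInstance, fun T x => ⟨?_, ?_⟩⟩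
      · rintro ⟨t, rfl⟩
        exact ⟨fun _ => ⟨t ≫ pullback.fst a b, by simp⟩,
          fun _ => ⟨t ≫ pullback.snd a b, by simp [pullback.condition]⟩⟩
      · rintro ⟨h, h'⟩
        obtain ⟨t, rfl⟩ := h hS
        obtain ⟨t', ht'⟩ := h' hT
        exact ⟨pullback.lift t t' ht'.symm, pullback.lift_fst_assoc _ _ _ _⟩
    · exact ⟨A, a, inferInstance, fun T x => by simp [hS, hT]⟩
    · exact ⟨B, b, inferInstance, fun T x => by simp [hS, hT]⟩
    · exact ⟨C, 𝟙 C, inferInstance, fun T x => by simp [hS, hT]⟩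
  choose Z m hm hZ using h1
  refine ⟨∏ᶜ Z, fun i => Pi.π Z i ≫ m i, ⟨fun i hi => ?_, fun i hi => ?_⟩, fun T x hx => ?_⟩
  · exact ((hZ i _ _).1 ⟨_, rfl⟩).1 hi
  · exact ((hZ i _ _).1 ⟨_, rfl⟩).2 hi
  · have h2 : ∀ i, ∃ t, t ≫ m i = x i := fun i => (hZ i _ _).2 ⟨hx.1 i, hx.2 i⟩
    choose t ht using h2
    refine ⟨Pi.lift t, fun i => by simp [ht], fun f hf => ?_⟩
    refine Pi.hom_ext _ _ fun i => ?_
    have := hm i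
    rw [← cancel_mono (m i)]
    simp [ht, hf]

section
variable {A B C : E} {a : A ⟶ C} {b : B ⟶ C}
  {O : MonoPair.{v} → E} {e : ∀ X : MonoPair.{v}, Fin X.n → (O X ⟶ C)}

lemma rep_ext (H : ∀ X, Represents a b X (O X) (e X)) {X : MonoPair.{v}} {T : E} {f g : T ⟶ O X}
    (h : ∀ i, f ≫ e X i = g ≫ e X i) : f = g :=
  ((H X).2 T (fun i => g ≫ e X i) ((H X).1.precomp g)).unique h fun _ => rfl

variable (H : ∀ X, Represents a b X (O X) (e X))

/-- The action on morphisms of the functor interpreting `MonoPair` in `E`. -/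
noncomputable def repMap {X Y : MonoPair.{v}} (f : X ⟶ Y) : O X ⟶ O Y :=
  ((H Y).2 (O X) (fun j => e X (f.idx j))
    ⟨fun j hj => (H X).1.1 _ (f.mapS j hj), fun j hj => (H X).1.2 _ (f.mapT j hj)⟩).choose

lemma repMap_e {X Y : MonoPair.{v}} (f : X ⟶ Y) (j) : repMap H f ≫ e Y j = e X (f.idx j) :=
  ((H Y).2 (O X) (fun j => e X (f.idx j))
    ⟨fun j hj => (H X).1.1 _ (f.mapS j hj), fun j hj => (H X).1.2 _ (f.mapT j hj)⟩).choose_spec.1 j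

/-- The functor interpreting `MonoPair` in `E`. -/
noncomputable def repFunctor : MonoPair.{v} ⥤ E where
  obj := O
  map f := repMap H f
  map_id X := rep_ext H fun i => by simp [repMap_e]
  map_comp f g := rep_ext H fun i => by simp [repMap_e]

lemma repFunctor_lex : PreservesFiniteLimits (repFunctor H) where
  preservesFiniteLimits J _ _ := ⟨fun {F} => by
    refine preservesLimit_of_preserves_limit_cone (limitConeIsLimit F) ?_
    have key2 : ∀ s : Cone (F ⋙ repFunctor H), ∃! l : s.pt ⟶ O (limitCone F).pt,
        ∀ j, l ≫ repMap H ((limitCone F).π.app j) = s.π.app j := by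
      intro s
      let p : ∀ j, s.pt ⟶ O (F.obj j) := fun j => s.π.app j
      have hp : ∀ {i j} (f : i ⟶ j), p i ≫ repMap H (F.map f) = p j := fun f => s.w f
      let x : Fin (limitCone F).pt.n → (s.pt ⟶ C) :=
        fun i => Quot.lift (fun a => p a.1 ≫ e (F.obj a.1) a.2) (by
          rintro _ _ ⟨f, x⟩
          simp only [← hp f, Category.assoc, repMap_e]) ((coords F).symm i)
      let r : ∀ j, (limitCone F).pt ⟶ F.obj j := fun j => (limitCone F).π.app j
      have hx : ∀ j y, x ((r j).idx y) = p j ≫ e (F.obj j) y := by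
        intro j y; simp [x, r, limitCone]
      have hs : ∀ i : Fin (limitCone F).pt.n, ∃ j y, (r j).idx y = i := by
        intro i
        obtain ⟨q, rfl⟩ := (coords F).surjective i
        obtain ⟨⟨j, y⟩, rfl⟩ := Quot.exists_rep q
        exact ⟨j, y, rfl⟩
      have hgood : Good a b (limitCone F).pt x := by
        constructor
        · rintro _ ⟨j, y, hy, rfl⟩
          obtain ⟨t, ht⟩ := ((H (F.obj j)).1.precomp (p j)).1 y hy
          exact ⟨t, ht.trans (hx j y).symm⟩
        · rintro _ ⟨j, y, hy, rfl⟩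
          obtain ⟨t, ht⟩ := ((H (F.obj j)).1.precomp (p j)).2 y hy
          exact ⟨t, ht.trans (hx j y).symm⟩
      obtain ⟨l, hl, hu⟩ := (H (limitCone F).pt).2 s.pt x hgood
      have hr : ∀ (l' : s.pt ⟶ O (limitCone F).pt) j y,
          (l' ≫ repMap H (r j)) ≫ e _ y = l' ≫ e _ ((r j).idx y) := fun l' j y => by
        rw [Category.assoc, repMap_e]
      refine ⟨l, fun j => rep_ext H (X := F.obj j) fun y => ?_, fun l' hl' => hu l' fun i => ?_⟩
      · exact (hr l j y).trans ((hl _).trans (hx j y))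
      · obtain ⟨j, y, rfl⟩ := hs i
        exact (hr l' j y).symm.trans ((congrArg (· ≫ e _ y) (hl' j)).trans (hx j y).symm)
    exact
      { lift := fun s => (key2 s).choose
        fac := fun s j => (key2 s).choose_spec.1 j
        uniq := fun s m hm => (key2 s).choose_spec.2 m hm }⟩
end

/-- Universal property of `MonoPair`, on objects: every pair of monomorphisms with common codomain
in a finitely complete category is, up to isomorphism, the image of the generating pair under a
functor preserving finite limits. -/
theorem exists_lex [HasFiniteLimits E] {A B C : E} (a : A ⟶ C) (b : B ⟶ C) [Mono a] [Mono b] :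
    ∃ (D : MonoPair.{v} ⥤ E) (_ : PreservesFiniteLimits D) (α : D.obj objA ≅ A) (β : D.obj objB ≅ B)
      (γ : D.obj objC ≅ C), D.map inclA ≫ γ.hom = α.hom ≫ a ∧ D.map inclB ≫ γ.hom = β.hom ≫ b := by
  choose O e H using exists_rep.{v} a b
  have HA : Represents a b objA A (fun _ => a) := ⟨⟨fun i _ => ⟨𝟙 _, by simp⟩, fun i h => h.elim⟩,
    fun T x hx => by
      obtain ⟨t, ht⟩ := hx.1 (0 : Fin 1) trivial
      refine ⟨t, fun i => by rw [ht]; congr 1; exact Subsingleton.elim (α := Fin 1) _ _,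
        fun y hy => ?_⟩
      rw [← cancel_mono a, ht]; exact hy (0 : Fin 1)⟩
  have HB : Represents a b objB B (fun _ => b) := ⟨⟨fun i h => h.elim, fun i _ => ⟨𝟙 _, by simp⟩⟩,
    fun T x hx => by
      obtain ⟨t, ht⟩ := hx.2 (0 : Fin 1) trivial
      refine ⟨t, fun i => by rw [ht]; congr 1; exact Subsingleton.elim (α := Fin 1) _ _,
        fun y hy => ?_⟩
      rw [← cancel_mono b, ht]; exact hy (0 : Fin 1)⟩
  have HC : Represents a b objC C (fun _ => 𝟙 C) := ⟨⟨fun i h => h.elim, fun i h => h.elim⟩,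
    fun T x hx => ⟨x (0 : Fin 1), fun i => by
      rw [Category.comp_id]; congr 1; exact Subsingleton.elim (α := Fin 1) _ _, fun y hy => by
      simpa using hy (0 : Fin 1)⟩⟩
  have iso : ∀ (X : MonoPair.{v}) (Z : E) (z : Fin X.n → (Z ⟶ C)), Represents a b X Z z →
      ∃ i : O X ≅ Z, ∀ j, i.hom ≫ z j = e X j := by
    intro X Z z hZ
    obtain ⟨f, hf, -⟩ := hZ.2 _ _ (H X).1
    obtain ⟨g, hg, -⟩ := (H X).2 _ _ hZ.1
    exact ⟨⟨f, g, rep_ext H fun i => by simp [hf, hg],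
      (hZ.2 _ _ hZ.1).unique (fun i => by simp [hf, hg]) (fun i => by simp)⟩, hf⟩
  obtain ⟨α, hα⟩ := iso _ _ _ HA
  obtain ⟨β, hβ⟩ := iso _ _ _ HB
  obtain ⟨γ, hγ⟩ := iso _ _ _ HC
  refine ⟨repFunctor H, repFunctor_lex H, α, β, γ, ?_, ?_⟩
  · have h0 := hγ (0 : Fin 1)
    rw [Category.comp_id] at h0
    rw [h0]
    exact (repMap_e H inclA _).trans (hα (0 : Fin 1)).symm
  · have h0 := hγ (0 : Fin 1)
    rw [Category.comp_id] at h0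
    rw [h0]
    exact (repMap_e H inclB _).trans (hβ (0 : Fin 1)).symm



instance : Mono inclA.{v} :=
  ⟨fun f _ h => hom_ext fun j => congrFun (congrArg Hom.idx h : (f ≫ inclA).idx = _) j⟩
instance : Mono inclB.{v} :=
  ⟨fun f _ h => hom_ext fun j => congrFun (congrArg Hom.idx h : (f ≫ inclB).idx = _) j⟩

/-- One of `C`, `A`, `B` and `A ∩ B`, according to the truth values of `s` and `t`. -/
def gen (s t : Prop) : MonoPair.{v} := ⟨1, {_i | s}, {_i | t}⟩
/-- The inclusion into `C`. -/
def genC (s t : Prop) : gen.{v} s t ⟶ objC := ⟨id, fun _ h => h.elim, fun _ h => h.elim⟩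

instance (s t : Prop) : Mono (genC.{v} s t) :=
  ⟨fun f _ h => hom_ext fun j => congrFun (congrArg Hom.idx h : (f ≫ genC s t).idx = _) j⟩

/-- The inclusion of `A ∩ B` into `A`. -/
def genA : gen.{v} True True ⟶ objA := ⟨id, fun _ _ => trivial, fun _ h => h.elim⟩
/-- The inclusion of `A ∩ B` into `B`. -/
def genB : gen.{v} True True ⟶ objB := ⟨id, fun _ h => h.elim, fun _ _ => trivial⟩

lemma isPullback_gen : IsPullback genA.{v} genB inclA inclB :=
  ⟨⟨rfl⟩, ⟨PullbackCone.IsLimit.mk _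
    (fun s => Hom.mk (X := s.pt) (Y := gen True True) s.fst.idx s.fst.mapS fun j _ => by
      have : s.fst.idx = s.snd.idx := congrArg Hom.idx s.condition
      rw [this]; exact s.snd.mapT j trivial)
    (fun s => rfl) (fun s => Hom.ext (congrArg Hom.idx s.condition :))
    (fun s m h _ => Hom.ext (congrArg Hom.idx h :))⟩⟩

lemma factors_gen (D : MonoPair.{v} ⥤ E) [PreservesFiniteLimits D] (s t : Prop) {T : E}
    (x : T ⟶ D.obj objC) :
    (∃ y, y ≫ D.map (genC s t) = x) ↔
      (s → ∃ y, y ≫ D.map inclA = x) ∧ (t → ∃ y, y ≫ D.map inclB = x) := by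
  by_cases hs : s <;> by_cases ht : t
  · obtain rfl := eq_true hs
    obtain rfl := eq_true ht
    have h := isPullback_gen.{v}.map D
    constructor
    · rintro ⟨y, rfl⟩
      exact ⟨fun _ => ⟨y ≫ D.map genA,
          (Category.assoc _ _ _).trans (congrArg (y ≫ ·) (D.map_comp _ _).symm)⟩,
        fun _ => ⟨y ≫ D.map genB,
          (Category.assoc _ _ _).trans (congrArg (y ≫ ·) (D.map_comp _ _).symm)⟩⟩
    · rintro ⟨h1, h2⟩
      obtain ⟨y, hy⟩ := h1 hs
      obtain ⟨z, hz⟩ := h2 ht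
      refine ⟨h.lift y z (hy.trans hz.symm), Eq.trans ?_ hy⟩
      refine Eq.trans ?_ (congrArg (· ≫ D.map inclA) (h.lift_fst y z (hy.trans hz.symm)))
      exact (congrArg (_ ≫ ·) (D.map_comp genA inclA)).trans (Category.assoc _ _ _).symm
  · obtain rfl := eq_true hs
    obtain rfl := eq_false ht
    exact ⟨fun h => ⟨fun _ => h, fun h => h.elim⟩, fun h => h.1 trivial⟩
  · obtain rfl := eq_false hs
    obtain rfl := eq_true ht
    exact ⟨fun h => ⟨fun h => h.elim, fun _ => h⟩, fun h => h.2 trivial⟩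
  · obtain rfl := eq_false hs
    obtain rfl := eq_false ht
    exact ⟨fun _ => ⟨fun h => h.elim, fun h => h.elim⟩,
      fun _ => ⟨x, (congrArg (x ≫ ·) (D.map_id _)).trans (Category.comp_id _)⟩⟩

/-- The `i`-th coordinate, with its membership conditions. -/
def coord (X : MonoPair.{v}) (i : Fin X.n) : X ⟶ gen (i ∈ X.S) (i ∈ X.T) :=
  ⟨fun _ => i, fun _ h => h, fun _ h => h⟩

/-- Every object is the product of its coordinates. -/
def coordIsLimit (X : MonoPair.{v}) : IsLimit (Fan.mk X X.coord) :=
  Fan.IsLimit.mk _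
    (fun s => Hom.mk (X := s.pt) (Y := X) (fun i => Hom.idx (s.proj i) (0 : Fin 1))
      (fun i hi => (s.proj i).mapS (0 : Fin 1) hi)
      (fun i hi => (s.proj i).mapT (0 : Fin 1) hi))
    (fun s i => hom_ext fun _ => congrArg (Hom.idx (s.proj i)) (Subsingleton.elim (α := Fin 1) _ _))
    (fun _ _ hm => hom_ext fun i => congrFun (congrArg Hom.idx (hm i)) (0 : Fin 1))

lemma lex_represents (D : MonoPair.{v} ⥤ E) [PreservesFiniteLimits D] (X : MonoPair.{v}) :
    Represents (D.map inclA) (D.map inclB) X (D.obj X) (fun i => D.map (X.ev i)) := by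
  have hev : ∀ i, X.ev i = X.coord i ≫ genC _ _ := fun _ => rfl
  have hlim : IsLimit (Fan.mk (D.obj X) fun i => D.map (X.coord i)) :=
    isLimitFanMkObjOfIsLimit D _ _ X.coordIsLimit
  refine ⟨⟨fun i hi => ?_, fun i hi => ?_⟩, fun T x hx => ?_⟩
  · exact ((factors_gen D (i ∈ X.S) (i ∈ X.T) _).1 ⟨D.map (X.coord i), (D.map_comp _ _).symm⟩).1 hi
  · exact ((factors_gen D (i ∈ X.S) (i ∈ X.T) _).1 ⟨D.map (X.coord i), (D.map_comp _ _).symm⟩).2 hi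
  · choose y hy using fun i => (factors_gen D (i ∈ X.S) (i ∈ X.T) (x i)).2 ⟨hx.1 i, hx.2 i⟩
    have hev' : ∀ i {f : T ⟶ D.obj X},
        f ≫ D.map (X.ev i) = (f ≫ D.map (X.coord i)) ≫ D.map (genC _ _) := fun i f => by
      rw [hev, D.map_comp, Category.assoc]
    refine ⟨Fan.IsLimit.lift hlim y, fun i => ?_, fun f hf => ?_⟩
    · refine (hev' i).trans (Eq.trans ?_ (hy i))
      congr 1
      exact Fan.IsLimit.fac hlim y i
    · refine Fan.IsLimit.hom_ext hlim _ _ fun i => ?_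
      rw [Fan.IsLimit.fac, ← cancel_mono (D.map (genC _ _)), hy, ← hf i]
      exact (hev' i).symm

/-- Universal property of `MonoPair`, on morphisms: a transformation between functors preserving
finite limits is the same as a compatible triple of morphisms at the generating objects. -/
theorem lex_ext (D D' : MonoPair.{v} ⥤ E) [PreservesFiniteLimits D] [PreservesFiniteLimits D']
    (α : D.obj objA ⟶ D'.obj objA) (β : D.obj objB ⟶ D'.obj objB) (γ : D.obj objC ⟶ D'.obj objC)
    (hα : D.map inclA ≫ γ = α ≫ D'.map inclA) (hβ : D.map inclB ≫ γ = β ≫ D'.map inclB) :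
    ∃! τ : D ⟶ D', τ.app objA = α ∧ τ.app objB = β ∧ τ.app objC = γ := by
  have H := lex_represents D
  have H' := lex_represents D'
  have hg : ∀ X : MonoPair.{v}, Good (D'.map inclA) (D'.map inclB) X
      (fun i => D.map (X.ev i) ≫ γ) := by
    refine fun X => ⟨fun i hi => ?_, fun i hi => ?_⟩
    · obtain ⟨t, ht⟩ := (H X).1.1 i hi
      exact ⟨t ≫ α, by rw [Category.assoc, ← hα, ← Category.assoc, ht]⟩
    · obtain ⟨t, ht⟩ := (H X).1.2 i hi
      exact ⟨t ≫ β, by rw [Category.assoc, ← hβ, ← Category.assoc, ht]⟩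
  choose τ hτ hu using fun X => (H' X).2 _ _ (hg X)
  have key : ∀ X (f : D.obj X ⟶ D'.obj X), (∀ i, f ≫ D'.map (X.ev i) = D.map (X.ev i) ≫ γ) →
      f = τ X := hu
  refine ⟨⟨τ, fun X Y f => ?_⟩, ⟨(key _ _ fun i => ?_).symm,
    (key _ _ fun i => ?_).symm, (key _ _ fun i => ?_).symm⟩, fun σ hσ => ?_⟩
  · refine rep_ext H' fun i => ?_
    have h1 := hτ Y i
    have h2 := hτ X (f.idx i)
    simp only [Category.assoc] at h1 h2 ⊢
    rw [h1, ← D'.map_comp, map_ev, h2, ← map_ev, D.map_comp, Category.assoc]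
  · have : objA.{v}.ev i = inclA := hom_ext fun j => Subsingleton.elim (α := Fin 1) _ _
    rw [this, hα]
  · have : objB.{v}.ev i = inclB := hom_ext fun j => Subsingleton.elim (α := Fin 1) _ _
    rw [this, hβ]
  · have : objC.{v}.ev i = 𝟙 _ := hom_ext fun j => Subsingleton.elim (α := Fin 1) _ _
    rw [this]; simp
  · ext X
    refine key _ _ fun i => ?_
    rw [← σ.naturality, hσ.2.2]

end Universal

end MonoPair

/-! ### The weights for finite unions -/

/-- The initial presheaf on the terminal category. -/
def emptyWeight : LexWeight.{v} where
  K := Discrete PUnit.{v + 1}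
  lex := by infer_instance
  weight := (Functor.const _).obj PEmpty.{v + 1}

/-- The union, in the presheaves on the free category with finite limits on `A ↣ C ↢ B`, of the
two subobjects of the presheaf represented by `C` which are represented by `A` and `B`. -/
def unionWeight : LexWeight.{v} where
  K := MonoPair.{v}
  weight := (Subfunctor.range (yoneda.map MonoPair.inclA.{v}) ⊔
    Subfunctor.range (yoneda.map MonoPair.inclB.{v})).toFunctor

/-- The class `Φ_∨` of lex-weights for finite unions. -/
def finiteUnionWeights : Set LexWeight.{v} := {emptyWeight, unionWeight}

/-! ### The elementary conditions -/

section Elementary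

variable (C : Type u) [Category.{v} C]

/-- A pushout square is stable under pullback if its pullback along any morphism into its vertex is
again a pushout square. -/
def IsStablePushout {C : Type u} [Category.{v} C] {P A B U : C}
    (p : P ⟶ A) (q : P ⟶ B) (i : A ⟶ U) (j : B ⟶ U) : Prop :=
  IsPushout p q i j ∧
    ∀ ⦃P' A' B' U' : C⦄ (p' : P' ⟶ A') (q' : P' ⟶ B') (i' : A' ⟶ U') (j' : B' ⟶ U')
      (hP : P' ⟶ P) (hA : A' ⟶ A) (hB : B' ⟶ B) (h : U' ⟶ U),
      IsPullback p' hP hA p → IsPullback q' hP hB q →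
      IsPullback i' hA h i → IsPullback j' hB h j → CommSq p' q' i' j' →
      IsPushout p' q' i' j'

/-- Every pullback `A ← A ∩ B → B` of a pair of monomorphisms `A ↣ X ↢ B` has a pushout, and this
pushout is stable under pullback. -/
def HasStablePushoutsOfMonoPullbacks : Prop :=
  ∀ ⦃P A B X : C⦄ (p : P ⟶ A) (q : P ⟶ B) (a : A ⟶ X) (b : B ⟶ X) [Mono a] [Mono b],
    IsPullback p q a b → ∃ (U : C) (i : A ⟶ U) (j : B ⟶ U), IsStablePushout p q i j

/-- Finite unions of subobjects exist, are stable under pullback and are effective: a binary union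
`A ∪ B` is the pushout of `A` and `B` over `A ∩ B`. -/
structure HasStableEffectiveFiniteUnions [HasFiniteLimits C] : Prop where
  exists_union : ∀ (X : C) (s : Set (Subobject X)), s.Finite → ∃ U, IsLUB s U
  stable : ∀ (X : C) (s : Set (Subobject X)) (U : Subobject X), s.Finite → IsLUB s U →
    ∀ (Y : C) (f : Y ⟶ X), IsLUB ((Subobject.pullback f).obj '' s) ((Subobject.pullback f).obj U)
  effective : ∀ (X : C) (A B U : Subobject X) (hU : IsLUB {A, B} U),
    IsPushout (Subobject.ofLE (A ⊓ B) A inf_le_left) (Subobject.ofLE (A ⊓ B) B inf_le_right)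
      (Subobject.ofLE A U (hU.1 (Set.mem_insert A {B})))
      (Subobject.ofLE B U (hU.1 (Set.mem_insert_of_mem A rfl)))

end Elementary

end LexColim

/-! The elementary conditions are linked through stability. Over a stable pushout, equality of
morphisms can be tested locally on the two legs, so the comparison from the pushout of an
intersection to the ambient object is monic (`IsStablePushout.mono_of_isPullback`). Such a pushout
is therefore a union, and stable effective unions are the same thing as these pushouts. The least
subobject of the terminal object supplies the strict initial object.

Exactness gives the elementary conditions because a left exact reflection inverts pullbacks of its
unit: reflections of presheaves in the completion are stable under pullback
(`IsLexExact.exists_isReflecting`). The empty presheaf and the pushout of representables over an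
intersection lie in the completion. In presheaves the first is strict and the second is stable by
adhesivity, and both properties descend to their reflections.

Conversely, take the canonical topology. Stability says exactly what is needed for the legs of each
pushout, and for the empty sieve on a strict initial object, to be covering. By induction on the
completion, each of its presheaves has a locally bijective morphism to a representable
(`InLexCompletion.hasLocalReflection`). Locally bijective morphisms are orthogonal to sheaves
(`IsLocallyBijective.existsUnique_extension`), hence to representables, so these morphisms are
reflections. They are also closed under finite limits (`IsLocallyBijective.limit`), so the reflector
is left exact. -/

namespace LexColim

/-! ### Stable pushouts of intersections versus stable effective unions. -/

section Elementary

variable {C : Type u} [Category.{v} C]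

/-- A stable pushout square can be pulled back along any morphism into its vertex. -/
lemma IsStablePushout.exists_pullback [HasPullbacks C] {P A B U : C} {p : P ⟶ A} {q : P ⟶ B}
    {i : A ⟶ U} {j : B ⟶ U} (H : IsStablePushout p q i j) {T : C} (z : T ⟶ U) :
    ∃ (P' A' B' : C) (p' : P' ⟶ A') (q' : P' ⟶ B') (i' : A' ⟶ T) (j' : B' ⟶ T)
      (hA : A' ⟶ A) (hB : B' ⟶ B),
      IsPullback i' hA z i ∧ IsPullback j' hB z j ∧ IsStablePushout p' q' i' j' := by
  have hA := IsPullback.of_hasPullback z i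
  have hB := IsPullback.of_hasPullback z j
  have hP := IsPullback.of_hasPullback (pullback.snd z i) p
  have hPi := hP.paste_horiz hA
  -- As `p ≫ i = q ≫ j`, the pullback of `P` computed through `A` also serves as the one through
  -- `B`.
  rw [H.1.w] at hPi
  have hQ := hPi.of_right' hB
  have e : pullback.fst (pullback.snd z i) p ≫ pullback.fst z i =
      hB.lift _ _ (by rw [hPi.w, Category.assoc]) ≫ pullback.fst z j := (hB.lift_fst _ _ _).symm
  refine ⟨_, _, _, _, _, _, _, _, _, hA, hB, H.2 _ _ _ _ _ _ _ z hP hQ hA hB ⟨e⟩, ?_⟩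
  intro P' A' B' U' p' q' i' j' kP kA kB k h1 h2 h3 h4 h5
  exact H.2 p' q' i' j' _ _ _ (k ≫ z) (h1.paste_vert hP) (h2.paste_vert hQ)
    (h3.paste_vert hA) (h4.paste_vert hB) h5

/-- Over a stable pushout, equality of morphisms can be tested locally. -/
lemma IsStablePushout.hom_ext_local [HasPullbacks C] {P A B U : C} {p : P ⟶ A} {q : P ⟶ B}
    {i : A ⟶ U} {j : B ⟶ U} (H : IsStablePushout p q i j) {T Y : C} (z : T ⟶ U) {f g : T ⟶ Y}
    (hi : ∀ ⦃S : C⦄ (e : S ⟶ T) (x : S ⟶ A), e ≫ z = x ≫ i → e ≫ f = e ≫ g)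
    (hj : ∀ ⦃S : C⦄ (e : S ⟶ T) (x : S ⟶ B), e ≫ z = x ≫ j → e ≫ f = e ≫ g) : f = g := by
  obtain ⟨P', A', B', p', q', i', j', hA, hB, h1, h2, h3⟩ := H.exists_pullback z
  exact h3.1.hom_ext (hi _ _ h1.w) (hj _ _ h2.w)

/-- The comparison morphism from a stable pushout of an intersection to the ambient object is a
monomorphism. -/
lemma IsStablePushout.mono_of_isPullback [HasPullbacks C] {P A B U X : C} {p : P ⟶ A} {q : P ⟶ B}
    {i : A ⟶ U} {j : B ⟶ U} (H : IsStablePushout p q i j) {a : A ⟶ X} {b : B ⟶ X} [Mono a] [Mono b]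
    (hP : IsPullback p q a b) {m : U ⟶ X} (hi : i ≫ m = a) (hj : j ≫ m = b) : Mono m := by
  -- A generalized element of `U` whose image in `X` lies in `A` factors through `i`. Where it comes
  -- from `A`, cancel `a`; where it comes from `B`, it lies in the intersection, on which the two
  -- legs agree.
  have key1 : ∀ ⦃T : C⦄ (z : T ⟶ U) (y : T ⟶ A), z ≫ m = y ≫ a → z = y ≫ i := by
    intro T z y h
    refine H.hom_ext_local z ?_ ?_
    · intro S e x hx
      have : x = e ≫ y := by
        rw [← cancel_mono a, ← hi, ← Category.assoc, ← hx, Category.assoc, h, hi, Category.assoc]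
      rw [hx, this, Category.assoc]
    · intro S e x hx
      have e1 : (e ≫ y) ≫ a = x ≫ b := by
        rw [Category.assoc, ← h, ← hj, ← Category.assoc, hx, Category.assoc]
      rw [hx, ← Category.assoc, ← hP.lift_fst _ _ e1, Category.assoc, H.1.w, ← Category.assoc,
        hP.lift_snd]
  have key2 : ∀ ⦃T : C⦄ (z : T ⟶ U) (y : T ⟶ B), z ≫ m = y ≫ b → z = y ≫ j := by
    intro T z y h
    refine H.hom_ext_local z ?_ ?_
    · intro S e x hx
      have e1 : x ≫ a = (e ≫ y) ≫ b := by
        rw [Category.assoc, ← h, ← hi, ← Category.assoc, ← hx, Category.assoc]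
      rw [hx, ← Category.assoc, ← hP.lift_snd _ _ e1, Category.assoc, ← H.1.w, ← Category.assoc,
        hP.lift_fst]
    · intro S e x hx
      have : x = e ≫ y := by
        rw [← cancel_mono b, ← hj, ← Category.assoc, ← hx, Category.assoc, h, hj, Category.assoc]
      rw [hx, this, Category.assoc]
  refine ⟨fun {T} s t h => H.hom_ext_local s ?_ ?_⟩
  · intro S e x hx
    rw [hx]
    refine (key1 _ _ ?_).symm
    rw [Category.assoc, ← h, ← Category.assoc, hx, Category.assoc, hi]
  · intro S e x hx
    rw [hx]
    refine (key2 _ _ ?_).symm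
    rw [Category.assoc, ← h, ← Category.assoc, hx, Category.assoc, hj]

lemma subobject_mk_le_iff {X A : C} (a : A ⟶ X) [Mono a] (V : Subobject X) :
    Subobject.mk a ≤ V ↔ ∃ t : A ⟶ (V : C), t ≫ V.arrow = a :=
  ⟨fun h => ⟨Subobject.ofMkLE a V h, Subobject.ofMkLE_arrow h⟩,
    fun ⟨t, ht⟩ => Subobject.mk_le_of_comm t ht⟩

/-- A monomorphism out of a pushout is a union. -/
lemma isLUB_of_isPushout {P A B U X : C} {p : P ⟶ A} {q : P ⟶ B}
    {i : A ⟶ U} {j : B ⟶ U} (H : IsPushout p q i j) {a : A ⟶ X} {b : B ⟶ X} {m : U ⟶ X}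
    [Mono a] [Mono b] [Mono m] (hi : i ≫ m = a) (hj : j ≫ m = b) :
    IsLUB {Subobject.mk a, Subobject.mk b} (Subobject.mk m) := by
  constructor
  · rintro _ (rfl | rfl)
    · exact Subobject.mk_le_mk_of_comm i hi
    · exact Subobject.mk_le_mk_of_comm j hj
  · intro V hV
    obtain ⟨s, hs⟩ := (subobject_mk_le_iff a V).1 (hV (Set.mem_insert _ _))
    obtain ⟨t, ht⟩ := (subobject_mk_le_iff b V).1 (hV (Set.mem_insert_of_mem _ rfl))
    have e : p ≫ s = q ≫ t := by
      rw [← cancel_mono V.arrow, Category.assoc, Category.assoc, hs, ht, ← hi, ← hj, H.w_assoc]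
    refine (subobject_mk_le_iff m V).2 ⟨H.desc s t e, H.hom_ext ?_ ?_⟩
    · rw [H.inl_desc_assoc, hs, hi]
    · rw [H.inr_desc_assoc, ht, hj]

/-- By strictness the domain of any parallel pair into the initial object is itself initial. -/
lemma initial_to_mono [HasInitial C] [HasStrictInitialObjects C] (X : C) :
    Mono (initial.to X) :=
  ⟨fun f g _ => by
    have := HasStrictInitialObjects.out f initialIsInitial
    exact (initialIsInitial.ofIso (asIso f).symm).hom_ext _ _⟩

variable [HasFiniteLimits C]

lemma isPullback_inf {X : C} (A B : Subobject X) :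
    IsPullback (Subobject.ofLE (A ⊓ B) A inf_le_left) (Subobject.ofLE (A ⊓ B) B inf_le_right)
      A.arrow B.arrow := by
  refine ⟨⟨by simp⟩, ⟨PullbackCone.IsLimit.mk _ (fun s => (A ⊓ B).factorThru (s.fst ≫ A.arrow)
    ((Subobject.inf_factors _).2 ⟨Subobject.factors_comp_arrow s.fst, ?_⟩)) ?_ ?_ ?_⟩⟩
  · rw [s.condition]
    exact Subobject.factors_comp_arrow s.snd
  · intro s
    simp [← cancel_mono A.arrow]
  · intro s
    simp [← cancel_mono B.arrow, s.condition]
  · intro s m h1 h2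
    rw [← cancel_mono (A ⊓ B).arrow]
    simp [← h1]

/-- Binary unions, as stable pushouts. -/
lemma exists_stable_union (h : HasStablePushoutsOfMonoPullbacks C) {X : C} (A B : Subobject X) :
    ∃ (U : C) (i : (A : C) ⟶ U) (j : (B : C) ⟶ U) (m : U ⟶ X), Mono m ∧
      i ≫ m = A.arrow ∧ j ≫ m = B.arrow ∧
      IsStablePushout (Subobject.ofLE (A ⊓ B) A inf_le_left)
        (Subobject.ofLE (A ⊓ B) B inf_le_right) i j := by
  obtain ⟨U, i, j, H⟩ := h _ _ _ _ (isPullback_inf A B)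
  have hi := H.1.inl_desc A.arrow B.arrow (isPullback_inf A B).w
  have hj := H.1.inr_desc A.arrow B.arrow (isPullback_inf A B).w
  exact ⟨U, i, j, _, H.mono_of_isPullback (isPullback_inf A B) hi hj, hi, hj, H⟩

/-- Pulling the pushout square back along `f` gives again a pushout with a monomorphism to `Y`,
hence a union there. -/
lemma exists_isLUB_pair (h : HasStablePushoutsOfMonoPullbacks C) {X : C} (A B : Subobject X) :
    ∃ U, IsLUB {A, B} U ∧ ∀ (Y : C) (f : Y ⟶ X),
      IsLUB {(Subobject.pullback f).obj A, (Subobject.pullback f).obj B}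
        ((Subobject.pullback f).obj U) := by
  obtain ⟨U, i, j, m, hm, hi, hj, H⟩ := exists_stable_union h A B
  refine ⟨Subobject.mk m, ?_, fun Y f => ?_⟩
  · simpa using isLUB_of_isPushout H.1 hi hj
  · have hU := IsPullback.of_hasPullback f m
    obtain ⟨P', A', B', p', q', i', j', hA, hB, h1, h2, h3⟩ :=
      H.exists_pullback (pullback.snd f m)
    have hA' := h1.flip.paste_vert hU.flip
    have hB' := h2.flip.paste_vert hU.flip
    rw [hi] at hA'
    rw [hj] at hB'
    have : Mono (i' ≫ pullback.fst f m) := hA'.mono_snd_of_mono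
    have : Mono (j' ≫ pullback.fst f m) := hB'.mono_snd_of_mono
    have eA := Subobject.pullback_obj_mk hA'
    have eB := Subobject.pullback_obj_mk hB'
    rw [Subobject.mk_arrow] at eA eB
    rw [eA, eB, Subobject.pullback_obj_mk hU.flip]
    exact isLUB_of_isPushout h3.1 rfl rfl

lemma isLUB_insert_iff {α : Type*} [PartialOrder α] {s : Set α} {a b c : α} (h : IsLUB s b) :
    IsLUB (insert a s) c ↔ IsLUB {a, b} c := by
  simp [IsLUB, upperBounds_insert, h.upperBounds_eq]

/-- Existence and stability are proved together, since adjoining one subobject to a set requires the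
stability of the union already formed. -/
lemma exists_isLUB_of_finite [HasInitial C] [HasStrictInitialObjects C]
    (h : HasStablePushoutsOfMonoPullbacks C) {X : C} {s : Set (Subobject X)} (hs : s.Finite) :
    ∃ U, IsLUB s U ∧ ∀ (Y : C) (f : Y ⟶ X),
      IsLUB ((Subobject.pullback f).obj '' s) ((Subobject.pullback f).obj U) := by
  induction s, hs using Set.Finite.induction_on with
  | empty =>
    have hm : ∀ Y : C, Mono (initial.to Y) := initial_to_mono
    have hbot : ∀ Y : C, IsLUB (∅ : Set (Subobject Y)) (Subobject.mk (initial.to Y)) := by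
      intro Y
      rw [isLUB_empty_iff]
      exact fun V => (subobject_mk_le_iff _ V).2 ⟨initial.to _, initialIsInitial.hom_ext _ _⟩
    refine ⟨_, hbot X, fun Y f => ?_⟩
    -- Any cone has a morphism to the initial object, so by strictness its vertex is initial.
    have hp : IsPullback (𝟙 (⊥_ C)) (initial.to Y) (initial.to X) f := by
      refine ⟨⟨initialIsInitial.hom_ext _ _⟩, ⟨PullbackCone.IsLimit.mk _ (fun s => s.fst) ?_ ?_ ?_⟩⟩
      · intro s
        simp
      · intro s
        have := HasStrictInitialObjects.out s.fst initialIsInitial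
        exact (initialIsInitial.ofIso (asIso s.fst).symm).hom_ext _ _
      · intro s m h1 _
        simpa using h1
    rw [Set.image_empty, Subobject.pullback_obj_mk hp]
    exact hbot Y
  | insert _ _ ih =>
    rename_i A s _ _
    obtain ⟨V, hV, hV'⟩ := ih
    obtain ⟨U, hU, hU'⟩ := exists_isLUB_pair h A V
    refine ⟨U, (isLUB_insert_iff hV).2 hU, fun Y f => ?_⟩
    rw [Set.image_insert_eq]
    exact (isLUB_insert_iff (hV' Y f)).2 (hU' Y f)

/-- Stable pushouts of intersections yield stable and effective finite unions. -/
theorem hasStableEffectiveFiniteUnions_of_pushouts [HasInitial C] [HasStrictInitialObjects C]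
    (h : HasStablePushoutsOfMonoPullbacks C) : HasStableEffectiveFiniteUnions C where
  exists_union X s hs := let ⟨U, hU, _⟩ := exists_isLUB_of_finite h hs; ⟨U, hU⟩
  stable X s U hs hU Y f := by
    obtain ⟨U', hU', hst⟩ := exists_isLUB_of_finite h hs
    rw [hU.unique hU']
    exact hst Y f
  effective X A B U hU := by
    obtain ⟨V, i, j, m, hm, hi, hj, H⟩ := exists_stable_union h A B
    have hV := isLUB_of_isPushout H.1 hi hj
    rw [Subobject.mk_arrow, Subobject.mk_arrow] at hV
    obtain rfl := hU.unique hV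
    refine H.1.of_iso (Iso.refl _) (Iso.refl _) (Iso.refl _) (Subobject.underlyingIso m).symm
      (by simp) (by simp) ?_ ?_
    · simp [← cancel_mono (Subobject.mk m).arrow, hi]
    · simp [← cancel_mono (Subobject.mk m).arrow, hj]

/-- Transports effectiveness from the chosen representatives of subobjects to arbitrary
monomorphisms and an arbitrary pullback. -/
lemma HasStableEffectiveFiniteUnions.isPushout (h : HasStableEffectiveFiniteUnions C)
    {P A B U X : C} {p : P ⟶ A} {q : P ⟶ B} {a : A ⟶ X} {b : B ⟶ X} {i : A ⟶ U} {j : B ⟶ U}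
    {m : U ⟶ X} [Mono a] [Mono b] [Mono m] (hi : i ≫ m = a) (hj : j ≫ m = b)
    (hP : IsPullback p q a b) (hU : IsLUB {Subobject.mk a, Subobject.mk b} (Subobject.mk m)) :
    IsPushout p q i j := by
  have H := h.effective X _ _ _ hU
  have hP' := isPullback_inf (Subobject.mk a) (Subobject.mk b)
  have hP'' : IsPullback
      (Subobject.ofLE (Subobject.mk a ⊓ Subobject.mk b) (Subobject.mk a) inf_le_left ≫
        (Subobject.underlyingIso a).hom)
      (Subobject.ofLE (Subobject.mk a ⊓ Subobject.mk b) (Subobject.mk b) inf_le_right ≫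
        (Subobject.underlyingIso b).hom) a b :=
    hP'.of_iso (Iso.refl _) (Subobject.underlyingIso a) (Subobject.underlyingIso b) (Iso.refl _)
      (by simp) (by simp) (by simp) (by simp)
  refine H.of_iso (hP''.isoIsPullback _ _ hP) (Subobject.underlyingIso a)
    (Subobject.underlyingIso b) (Subobject.underlyingIso m) (by simp) (by simp) ?_ ?_
  · rw [← cancel_mono m]
    simp [hi]
  · rw [← cancel_mono m]
    simp [hj]

/-- Stable and effective finite unions yield stable pushouts of intersections. -/
theorem HasStableEffectiveFiniteUnions.hasStablePushouts (h : HasStableEffectiveFiniteUnions C) :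
    HasStablePushoutsOfMonoPullbacks C := by
  intro P A B X p q a b _ _ hP
  obtain ⟨V, hV⟩ := h.exists_union X {Subobject.mk a, Subobject.mk b} (Set.toFinite _)
  obtain ⟨i, hi⟩ := (subobject_mk_le_iff a V).1 (hV.1 (Set.mem_insert _ _))
  obtain ⟨j, hj⟩ := (subobject_mk_le_iff b V).1 (hV.1 (Set.mem_insert_of_mem _ rfl))
  have hV' : IsLUB {Subobject.mk a, Subobject.mk b} (Subobject.mk V.arrow) := by
    rwa [Subobject.mk_arrow]
  refine ⟨V, i, j, h.isPushout hi hj hP hV', ?_⟩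
  intro P' A' B' U' p' q' i' j' kP kA kB k h1 h2 h3 h4 h5
  have ia : IsPullback (𝟙 _) i a V.arrow :=
    ⟨⟨by simp [hi]⟩, ⟨PullbackCone.IsLimit.mk _ (fun s => s.fst) (fun s => by simp)
      (fun s => by rw [← cancel_mono V.arrow, Category.assoc, hi, s.condition])
      (fun s m hm _ => by simpa using hm)⟩⟩
  have jb : IsPullback (𝟙 _) j b V.arrow :=
    ⟨⟨by simp [hj]⟩, ⟨PullbackCone.IsLimit.mk _ (fun s => s.fst) (fun s => by simp)
      (fun s => by rw [← cancel_mono V.arrow, Category.assoc, hj, s.condition])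
      (fun s m hm _ => by simpa using hm)⟩⟩
  have hA := h3.flip.paste_horiz ia
  have hB := h4.flip.paste_horiz jb
  have : Mono i' := hA.mono_snd_of_mono
  have : Mono j' := hB.mono_snd_of_mono
  -- Along `k ≫ V.arrow` the union `V` pulls back to all of `U'`, so by stability `A'` and `B'` have
  -- union `U'` itself.
  have hV2 : IsPullback k (𝟙 _) V.arrow (k ≫ V.arrow) :=
    ⟨⟨by simp⟩, ⟨PullbackCone.IsLimit.mk _ (fun s => s.snd)
      (fun s => by rw [← cancel_mono V.arrow, Category.assoc, s.condition]) (fun s => by simp)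
      (fun s m _ hm => by simpa using hm)⟩⟩
  have key := h.stable _ _ _ (Set.toFinite _) hV' _ (k ≫ V.arrow)
  rw [Set.image_pair, Subobject.pullback_obj_mk hA, Subobject.pullback_obj_mk hB,
    Subobject.pullback_obj_mk hV2] at key
  have hPij : IsPullback p q i j :=
    ⟨⟨by rw [← cancel_mono V.arrow, Category.assoc, hi, Category.assoc, hj, hP.w]⟩,
      ⟨PullbackCone.IsLimit.mk _
        (fun s => hP.lift s.fst s.snd (by rw [← hi, ← hj, s.condition_assoc]))
        (fun s => by simp) (fun s => by simp)
        (fun s m h1 h2 => hP.hom_ext (by simpa using h1) (by simpa using h2))⟩⟩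
  -- Pasting, then cancelling the pullback that defines `B'`, identifies `P'` with the intersection
  -- of `A'` and `B'` in `U'`.
  have hP' := h1.flip.paste_horiz hPij.flip
  rw [← h2.w, ← h3.w] at hP'
  exact h.isPushout (Category.comp_id _) (Category.comp_id _)
    (hP'.of_right h5.w.symm h4.flip).flip key

/-- The least subobject of the terminal object is a strict initial object. -/
theorem HasStableEffectiveFiniteUnions.exists_strict_initial
    (h : HasStableEffectiveFiniteUnions C) : HasInitial C ∧ HasStrictInitialObjects C := by
  obtain ⟨Z, hZ⟩ := h.exists_union (⊤_ C) ∅ Set.finite_empty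
  -- The pullback of `Z` to `T` is the least subobject by stability, and the greatest because `Z`
  -- pulls back to `⊤` along its own arrow.
  have hsub : ∀ ⦃T : C⦄ (_ : T ⟶ (Z : C)) (V : Subobject T), V = ⊤ := by
    intro T t V
    have := h.stable _ _ _ Set.finite_empty hZ T (t ≫ Z.arrow)
    rw [Set.image_empty, Subobject.pullback_comp, isLUB_empty_iff] at this
    have e : (Subobject.pullback Z.arrow).obj Z = ⊤ := by
      simpa using Subobject.pullback_self Z.arrow
    rw [e, Subobject.pullback_top] at this
    exact top_le_iff.1 (this V)
  have hpar : ∀ ⦃T : C⦄ (_ : T ⟶ (Z : C)) ⦃Y : C⦄ (f g : T ⟶ Y), f = g := by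
    intro T t Y f g
    have : IsIso (equalizer.ι f g) := by
      rw [Subobject.isIso_iff_mk_eq_top]
      exact hsub t _
    rw [← cancel_epi (equalizer.ι f g), equalizer.condition]
  have hiso : ∀ ⦃T : C⦄ (t : T ⟶ (Z : C)), IsIso t := by
    intro T t
    have : Mono t := ⟨fun f g _ => hpar (f ≫ t) _ _⟩
    rw [Subobject.isIso_iff_mk_eq_top]
    exact hsub (𝟙 _) _
  -- The projection from `Z ⨯ Y` to `Z` is invertible, which yields a morphism from `Z` to `Y`.
  have hinit : IsInitial (Z : C) := IsInitial.ofUniqueHom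
    (fun Y => have := hiso (prod.fst : (Z : C) ⨯ Y ⟶ Z); inv (prod.fst : (Z : C) ⨯ Y ⟶ Z) ≫ prod.snd)
    (fun Y f => hpar (𝟙 _) _ _)
  refine ⟨hinit.hasInitial, ⟨fun f hI => ?_⟩⟩
  have := hiso (f ≫ hI.to (Z : C))
  have := hiso (hI.to (Z : C))
  exact IsIso.of_isIso_comp_right f (hI.to (Z : C))

end Elementary
-- Unions of presheaves, the completion, and reflections to representables.
section Presheaf

variable {C : Type u} [Category.{v} C]

section Union

variable {A B X P : Cᵒᵖ ⥤ Type v} (a : A ⟶ X) (b : B ⟶ X)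

/-- The union of the images of two morphisms of presheaves. -/
abbrev unionRange : Subfunctor X := Subfunctor.range a ⊔ Subfunctor.range b

/-- The first inclusion into the union. -/
abbrev unionInl : A ⟶ (unionRange a b).toFunctor := Subfunctor.lift a le_sup_left

/-- The second inclusion into the union. -/
abbrev unionInr : B ⟶ (unionRange a b).toFunctor := Subfunctor.lift b le_sup_right

variable {a b}

/-- Pushouts of presheaves are pointwise, and in sets a union is the pushout over the intersection.
-/
lemma isPushout_unionRange [Mono a] [Mono b] {p : P ⟶ A} {q : P ⟶ B} (h : IsPullback p q a b) :
    IsPushout p q (unionInl a b) (unionInr a b) := by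
  refine IsPushout.of_forall_isPushout_app fun T => ?_
  have hb : Function.Injective (b.app T) := (mono_iff_injective _).1 inferInstance
  refine Types.isPushout_of_isPullback_of_mono (k := (unionRange a b).ι.app T) (h.app T)
    rfl rfl ?_ fun x y _ _ hxy => hb hxy
  refine Set.eq_univ_of_forall ?_
  rintro ⟨x, ⟨y, hy⟩ | ⟨y, hy⟩⟩
  · exact Or.inl ⟨y, Subtype.ext hy⟩
  · exact Or.inr ⟨y, Subtype.ext hy⟩

end Union

/-- The presheaf underlying `unionWeight`. -/
abbrev unionPresheaf : MonoPair.{v}ᵒᵖ ⥤ Type v :=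
  (unionRange (yoneda.map MonoPair.inclA.{v}) (yoneda.map MonoPair.inclB.{v})).toFunctor

lemma mem_unionPresheaf_iff {k : MonoPair.{v}} (x : k ⟶ MonoPair.objC) :
    x ∈ (unionRange (yoneda.map MonoPair.inclA.{v}) (yoneda.map MonoPair.inclB.{v})).obj (op k) ↔
    (∃ y : k ⟶ MonoPair.objA, y ≫ MonoPair.inclA = x) ∨
      (∃ y : k ⟶ MonoPair.objB, y ≫ MonoPair.inclB = x) := Iff.rfl

variable (D : MonoPair.{v} ⥤ Cᵒᵖ ⥤ Type v)

/-- The union of the two given subobjects, as a cocone weighted by the union weight. -/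
def unionCocone : WeightedCocone unionPresheaf.{v} D
    (unionRange (D.map MonoPair.inclA) (D.map MonoPair.inclB)).toFunctor where
  leg k x := Subfunctor.lift (D.map x.1) (by
    obtain ⟨y, hy⟩ | ⟨y, hy⟩ := (mem_unionPresheaf_iff _).1 x.2
    · rw [← hy, D.map_comp]
      exact (Subfunctor.range_comp_le _ _).trans le_sup_left
    · rw [← hy, D.map_comp]
      exact (Subfunctor.range_comp_le _ _).trans le_sup_right)
  naturality f x := by
    rw [← cancel_mono (Subfunctor.ι _)]
    exact D.map_comp f x.1

/-- The weight is generated by the two inclusions, as elements at `objA` and `objB`, which agree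
over the intersection. A weighted cocone thus amounts to a cocone under the span of `A ∩ B`, and `D`
preserves that intersection. -/
lemma unionCocone_isColimit [PreservesFiniteLimits D] : (unionCocone D).IsColimit := by
  intro Y s
  have hP := isPushout_unionRange (MonoPair.isPullback_gen.{v}.map D)
  let xA : unionPresheaf.{v}.obj (op MonoPair.objA) :=
    ⟨MonoPair.inclA, (mem_unionPresheaf_iff _).2 (Or.inl ⟨𝟙 _, Category.id_comp _⟩)⟩
  let xB : unionPresheaf.{v}.obj (op MonoPair.objB) :=
    ⟨MonoPair.inclB, (mem_unionPresheaf_iff _).2 (Or.inr ⟨𝟙 _, Category.id_comp _⟩)⟩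
  have e : D.map MonoPair.genA ≫ s.leg _ xA = D.map MonoPair.genB ≫ s.leg _ xB := by
    rw [← s.naturality, ← s.naturality]
    congr 1
  refine ⟨hP.desc _ _ e, fun k x => ?_, fun f hf => hP.hom_ext ?_ ?_⟩
  · obtain ⟨x, hx⟩ := x
    obtain ⟨y, rfl⟩ | ⟨y, rfl⟩ := (mem_unionPresheaf_iff _).1 hx
    · have e1 : s.leg k ⟨y ≫ MonoPair.inclA, hx⟩ = D.map y ≫ s.leg _ xA :=
        s.naturality (k := k) (l := MonoPair.objA) y xA
      have e2 : (unionCocone D).leg k ⟨y ≫ MonoPair.inclA, hx⟩ =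
        D.map y ≫ unionInl _ _ := (unionCocone D).naturality (k := k) (l := MonoPair.objA) y xA
      rw [e1, e2, Category.assoc, hP.inl_desc]
    · have e1 : s.leg k ⟨y ≫ MonoPair.inclB, hx⟩ = D.map y ≫ s.leg _ xB :=
        s.naturality (k := k) (l := MonoPair.objB) y xB
      have e2 : (unionCocone D).leg k ⟨y ≫ MonoPair.inclB, hx⟩ =
        D.map y ≫ unionInr _ _ := (unionCocone D).naturality (k := k) (l := MonoPair.objB) y xB
      rw [e1, e2, Category.assoc, hP.inr_desc]
  · rw [hP.inl_desc]
    exact hf _ xA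
  · rw [hP.inr_desc]
    exact hf _ xB

/-- Weighted colimits are unique up to isomorphism. -/
lemma WeightedCocone.IsColimit.nonempty_iso {K : Type w} [Category.{w'} K] {E : Type u}
    [Category.{v} E] {φ : Kᵒᵖ ⥤ Type w'} {D : K ⥤ E} {X Y : E} {c : WeightedCocone φ D X}
    {d : WeightedCocone φ D Y} (hc : c.IsColimit) (hd : d.IsColimit) : Nonempty (X ≅ Y) := by
  obtain ⟨f, hf, -⟩ := hc Y d
  obtain ⟨g, hg, -⟩ := hd X c
  exact ⟨⟨f, g,
    (hc X c).unique (fun k x => by rw [← Category.assoc, hf, hg]) (fun k x => Category.comp_id _),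
    (hd Y d).unique (fun k x => by rw [← Category.assoc, hg, hf])
      (fun k x => Category.comp_id _)⟩⟩

/-- The functor with constant value a terminal object preserves limits. -/
lemma preservesFiniteLimits_const {K : Type w} [Category.{w'} K] {E : Type u} [Category.{v} E]
    {X : E} (hX : IsTerminal X) : PreservesFiniteLimits ((Functor.const K).obj X) where
  preservesFiniteLimits _ _ _ := ⟨⟨fun _ => ⟨
    { lift := fun _ => hX.from _
      fac := fun _ _ => hX.hom_ext _ _
      uniq := fun _ _ _ => hX.hom_ext _ _ }⟩⟩⟩

variable (C) in
/-- The empty presheaf. -/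
abbrev emptyPresheaf : Cᵒᵖ ⥤ Type v := (Functor.const _).obj PEmpty.{v + 1}

/-- The empty presheaf is initial. -/
def emptyPresheafIsInitial : IsInitial (emptyPresheaf C) :=
  IsInitial.ofUniqueHom (fun F => { app := fun T => ↾fun x : PEmpty => x.elim
                                    naturality := fun _ _ _ => by ext x; exact x.elim })
    (fun F f => by ext T x; exact x.elim)

/-- A diagram on the terminal category preserves finite limits only at a terminal object, hence the
choice of the terminal representable. -/
lemma inLexCompletion_empty [HasFiniteLimits C] :
    InLexCompletion finiteUnionWeights.{v} C (emptyPresheaf C) := by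
  have hT : IsTerminal (yoneda.obj (⊤_ C)) := IsTerminal.isTerminalObj yoneda _ terminalIsTerminal
  refine InLexCompletion.lexColimit emptyWeight (Or.inl rfl)
    ((Functor.const _).obj (yoneda.obj (⊤_ C))) (preservesFiniteLimits_const hT)
    (fun _ => .representable _) _ ⟨fun _ x => x.elim, fun _ x => x.elim⟩ fun Y s => ?_
  exact ⟨emptyPresheafIsInitial.to Y, fun k x => x.elim,
    fun f _ => emptyPresheafIsInitial.hom_ext _ _⟩

lemma InLexCompletion.of_isPullback {Φ : Set LexWeight.{v}} {P F G H : Cᵒᵖ ⥤ Type v} {p : P ⟶ F}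
    {q : P ⟶ G} {f : F ⟶ H} {g : G ⟶ H} (h : IsPullback p q f g) (hF : InLexCompletion Φ C F)
    (hG : InLexCompletion Φ C G) (hH : InLexCompletion Φ C H) : InLexCompletion Φ C P := by
  refine InLexCompletion.finiteLimit (J := WalkingCospan) (cospan f g) ?_ _ h.isLimit
  rintro (_ | _ | _)
  · exact hH
  · exact hF
  · exact hG

/-- A functor preserving finite limits on the free category on two monomorphisms takes values in the
completion as soon as it does so at the generators. -/
lemma inLexCompletion_monoPair {Φ : Set LexWeight.{v}} [PreservesFiniteLimits D]
    (hA : InLexCompletion Φ C (D.obj MonoPair.objA))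
    (hB : InLexCompletion Φ C (D.obj MonoPair.objB))
    (hC : InLexCompletion Φ C (D.obj MonoPair.objC)) (k : MonoPair.{v}) :
    InLexCompletion Φ C (D.obj k) := by
  refine InLexCompletion.finiteLimit (J := Discrete (Fin k.n)) _ ?_ _
    (isLimitFanMkObjOfIsLimit D _ _ k.coordIsLimit)
  rintro ⟨i⟩
  change InLexCompletion Φ C (D.obj (MonoPair.gen (i ∈ k.S) (i ∈ k.T)))
  by_cases hs : i ∈ k.S <;> by_cases ht : i ∈ k.T
  · rw [eq_true hs, eq_true ht]
    exact .of_isPullback (MonoPair.isPullback_gen.{v}.map D) hA hB hC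
  · rw [eq_true hs, eq_false ht]
    exact hA
  · rw [eq_false hs, eq_true ht]
    exact hB
  · rw [eq_false hs, eq_false ht]
    exact hC

/-- Every pushout of representables over the intersection of two monomorphisms lies in the
completion. -/
lemma exists_pushout_inLexCompletion [HasFiniteLimits C] {P A B X : C} {p : P ⟶ A} {q : P ⟶ B}
    {a : A ⟶ X} {b : B ⟶ X} [Mono a] [Mono b] (h : IsPullback p q a b) :
    ∃ (G : Cᵒᵖ ⥤ Type v) (α : yoneda.obj A ⟶ G) (β : yoneda.obj B ⟶ G),
      InLexCompletion finiteUnionWeights.{v} C G ∧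
      IsPushout (yoneda.map p) (yoneda.map q) α β := by
  obtain ⟨D, hD, α, β, γ, hα, hβ⟩ := MonoPair.exists_lex.{v} (yoneda.map a) (yoneda.map b)
  have hG := MonoPair.isPullback_gen.{v}.map D
  have hP : IsPullback (D.map MonoPair.genA ≫ α.hom) (D.map MonoPair.genB ≫ β.hom)
      (yoneda.map a) (yoneda.map b) :=
    hG.of_iso (Iso.refl _) α β γ (by simp) (by simp) hα hβ
  refine ⟨_, α.inv ≫ unionInl _ _, β.inv ≫ unionInr _ _,
    .lexColimit unionWeight (Or.inr rfl) D hD (inLexCompletion_monoPair D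
      (.iso α.symm (.representable _)) (.iso β.symm (.representable _))
      (.iso γ.symm (.representable _))) _ _ (unionCocone_isColimit D), ?_⟩
  refine (isPushout_unionRange hG).of_iso (hP.isoIsPullback _ _ (h.map yoneda)) α β (Iso.refl _)
    ?_ ?_ ?_ ?_
  · simp
  · simp
  · simp
  · simp

/-! ### Reflections of presheaves to representables -/

/-- A morphism from a presheaf to a representable exhibiting the representing object as a reflection
of the presheaf. -/
def IsReflecting {F : Cᵒᵖ ⥤ Type v} {X : C} (η : F ⟶ yoneda.obj X) : Prop :=
  ∀ (Y : C) (g : F ⟶ yoneda.obj Y), ∃! f : X ⟶ Y, η ≫ yoneda.map f = g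

/-- A reflection of a pushout of representables is a pushout. -/
lemma IsReflecting.isPushout {P A B U : C} {G : Cᵒᵖ ⥤ Type v} {η : G ⟶ yoneda.obj U}
    (hη : IsReflecting η) {p : P ⟶ A} {q : P ⟶ B} {α : yoneda.obj A ⟶ G} {β : yoneda.obj B ⟶ G}
    (h : IsPushout (yoneda.map p) (yoneda.map q) α β) {i : A ⟶ U} {j : B ⟶ U}
    (hi : yoneda.map i = α ≫ η) (hj : yoneda.map j = β ≫ η) : IsPushout p q i j := by
  have hw : p ≫ i = q ≫ j := yoneda.map_injective (by
    rw [yoneda.map_comp, yoneda.map_comp, hi, hj, h.w_assoc])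
  have key : ∀ {Y : C} (f : A ⟶ Y) (g : B ⟶ Y), p ≫ f = q ≫ g →
      ∃! t : U ⟶ Y, i ≫ t = f ∧ j ≫ t = g := by
    intro Y f g e
    have e' : yoneda.map p ≫ yoneda.map f = yoneda.map q ≫ yoneda.map g := by
      rw [← yoneda.map_comp, e, yoneda.map_comp]
    obtain ⟨t, ht, hu⟩ := hη Y (h.desc _ _ e')
    refine ⟨t, ⟨yoneda.map_injective ?_, yoneda.map_injective ?_⟩, fun s hs => hu s ?_⟩
    · rw [yoneda.map_comp, hi, Category.assoc, ht, h.inl_desc]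
    · rw [yoneda.map_comp, hj, Category.assoc, ht, h.inr_desc]
    · refine h.hom_ext ?_ ?_
      · rw [h.inl_desc, ← Category.assoc, ← hi, ← yoneda.map_comp, hs.1]
      · rw [h.inr_desc, ← Category.assoc, ← hj, ← yoneda.map_comp, hs.2]
  exact ⟨⟨hw⟩, ⟨PushoutCocone.IsColimit.mk _ (fun s => (key _ _ s.condition).choose)
    (fun s => (key _ _ s.condition).choose_spec.1.1)
    (fun s => (key _ _ s.condition).choose_spec.1.2)
    (fun s m h1 h2 => (key _ _ s.condition).choose_spec.2 m ⟨h1, h2⟩)⟩⟩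

lemma IsReflecting.nonempty_isInitial {X : C} {F : Cᵒᵖ ⥤ Type v} {η : F ⟶ yoneda.obj X}
    (hη : IsReflecting η) (hF : IsInitial F) : Nonempty (IsInitial X) :=
  ⟨IsInitial.ofUniqueHom (fun Y => (hη Y (hF.to _)).choose)
    (fun Y f => (hη Y (hF.to _)).choose_spec.2 f (hF.hom_ext _ _))⟩

/-- In a lex-exact category, presheaves in the completion have reflections, which are stable under
pullback. -/
theorem IsLexExact.exists_isReflecting [HasFiniteLimits C] {Φ : Set LexWeight.{v}}
    (h : IsLexExact Φ C) {F : Cᵒᵖ ⥤ Type v} (hF : InLexCompletion Φ C F) :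
    ∃ (X : C) (η : F ⟶ yoneda.obj X), IsReflecting η ∧
      ∀ {Y : C} {V : Cᵒᵖ ⥤ Type v} (k : Y ⟶ X) (s : V ⟶ yoneda.obj Y) (t : V ⟶ F),
        IsPullback s t (yoneda.map k) η → IsReflecting s := by
  obtain ⟨L, ⟨adj⟩, hL⟩ := h
  let W := lexCompletionUnit Φ C
  let ff : W.FullyFaithful := Functor.FullyFaithful.ofCompFaithful (G := (lexCompletion Φ C).ι)
    (Yoneda.fullyFaithful)
  have := ff.full
  have := ff.faithful
  -- Any morphism to `W.obj X` inverted by `L` is reflecting: transposing along the adjunction, with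
  -- the counit invertible, solves for `f` uniquely.
  have refl : ∀ {G : (lexCompletion Φ C).FullSubcategory} {X : C} (η : G ⟶ W.obj X),
      IsIso (L.map η) → IsReflecting η.hom := by
    intro G X η hη Y g
    let g' : G ⟶ W.obj Y := ObjectProperty.homMk g
    have key : ∀ f : X ⟶ Y, η.hom ≫ yoneda.map f = g ↔ f = inv (adj.counit.app X) ≫ inv (L.map η)
        ≫ (adj.homEquiv _ _).symm g' := by
      intro f
      rw [IsIso.eq_inv_comp, IsIso.eq_inv_comp, Equiv.eq_symm_apply]
      have e : adj.homEquiv _ _ (L.map η ≫ adj.counit.app X ≫ f) = η ≫ W.map f := by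
        rw [adj.homEquiv_naturality_left, adj.homEquiv_naturality_right]
        simp [W, Adjunction.homEquiv_unit]
      rw [e]
      exact ⟨fun h => ObjectProperty.hom_ext _ h, fun h => congrArg (fun m => m.hom) h⟩
    exact ⟨_, (key _).2 rfl, fun f hf => (key f).1 hf⟩
  let F' : (lexCompletion Φ C).FullSubcategory := ⟨F, hF⟩
  have hunit : IsIso (L.map (adj.unit.app F')) := by
    infer_instance
  refine ⟨L.obj F', (adj.unit.app F').hom, refl _ hunit, fun {Y V} k s t hp => ?_⟩
  -- The pullback stays in the completion, so `L` preserves it and inverts the base change of the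
  -- unit.
  let V' : (lexCompletion Φ C).FullSubcategory :=
    ⟨V, .of_isPullback hp (.representable _) hF (.representable _)⟩
  let s' : V' ⟶ W.obj Y := ObjectProperty.homMk s
  let t' : V' ⟶ F' := ObjectProperty.homMk t
  have hp' : IsPullback s' t' (W.map k) (adj.unit.app F') :=
    IsPullback.of_map_of_faithful (lexCompletion Φ C).ι hp
  refine refl s' ?_
  have := hp'.map L
  exact this.isIso_fst_of_isIso

end Presheaf
-- From exactness to the elementary conditions.
section Exact

variable {C : Type u} [Category.{v} C] [HasFiniteLimits C]

/-- An initial object which is the reflection of the empty presheaf is strict. -/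
theorem IsLexExact.exists_strict_initial (h : IsLexExact finiteUnionWeights.{v} C) :
    HasInitial C ∧ HasStrictInitialObjects C := by
  obtain ⟨Z, η, hη, hst⟩ := h.exists_isReflecting inLexCompletion_empty
  obtain ⟨hZ⟩ := hη.nonempty_isInitial emptyPresheafIsInitial
  refine ⟨hZ.hasInitial, ⟨fun {I A} f hI => ?_⟩⟩
  have hp := IsPullback.of_hasPullback (yoneda.map (f ≫ hI.to Z)) η
  -- The pullback of the empty presheaf is empty, and its reflection is `A`.
  have hV : IsInitial (pullback (yoneda.map (f ≫ hI.to Z)) η) := by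
    have := HasStrictInitialObjects.out (pullback.snd (yoneda.map (f ≫ hI.to Z)) η)
      emptyPresheafIsInitial
    exact emptyPresheafIsInitial.ofIso (asIso (pullback.snd _ η)).symm
  obtain ⟨hA⟩ := (hst _ _ _ hp).nonempty_isInitial hV
  exact ⟨hI.to A, hA.hom_ext _ _, hI.hom_ext _ _⟩

/-- Finite-union exactness yields stable pushouts of intersections. -/
theorem IsLexExact.hasStablePushouts (h : IsLexExact finiteUnionWeights.{v} C) :
    HasStablePushoutsOfMonoPullbacks C := by
  intro P A B X p q a b _ _ hP
  obtain ⟨G, α, β, hG, hpo⟩ := exists_pushout_inLexCompletion hP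
  obtain ⟨U, η, hη, hst⟩ := h.exists_isReflecting hG
  refine ⟨U, yoneda.preimage (α ≫ η), yoneda.preimage (β ≫ η), hη.isPushout hpo (by simp)
    (by simp), ?_⟩
  intro P' A' B' U' p' q' i' j' kP kA kB k h1 h2 h3 h4 h5
  have hV := IsPullback.of_hasPullback (yoneda.map k) η
  have hA := h3.flip.map yoneda
  have hB := h4.flip.map yoneda
  rw [yoneda.map_preimage] at hA hB
  have hA' := (hA.of_bot' hV.flip).flip
  have hB' := (hB.of_bot' hV.flip).flip
  have : Mono p := hP.mono_fst_of_mono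
  -- The van Kampen property, available because `p` is monic, makes the pulled-back square a pushout
  -- with vertex the pullback of `η`; the reflection of that pullback is `U'`.
  refine (hst k _ _ hV).isPushout
    ((Adhesive.van_kampen hpo _ _ _ _ _ _ _ _ (h1.map yoneda) (h2.map yoneda) ⟨hA'.w⟩ ⟨hB'.w⟩
      ⟨hV.hom_ext ?_ ?_⟩).2 ⟨hA', hB'⟩) ?_ ?_
  · simp only [Category.assoc, IsPullback.lift_snd]
    rw [← yoneda.map_comp, h5.w, yoneda.map_comp]
  · simp only [Category.assoc, IsPullback.lift_fst]
    rw [← yoneda.map_comp_assoc, h1.w, yoneda.map_comp_assoc, hpo.w, ← yoneda.map_comp_assoc,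
      ← h2.w, yoneda.map_comp_assoc]
  · simp
  · simp

end Exact
-- Locally bijective morphisms: orthogonality to sheaves and finite limits.
section LocallyBijective

variable {C : Type u} [Category.{v} C] (J : GrothendieckTopology C)

/-- A morphism of presheaves which is locally injective and locally surjective. -/
structure IsLocallyBijective {F G : Cᵒᵖ ⥤ Type v} (η : F ⟶ G) : Prop where
  inj : Presheaf.IsLocallyInjective J η
  surj : Presheaf.IsLocallySurjective J η

variable {J}

lemma isLocallyBijective_of_isIso {F G : Cᵒᵖ ⥤ Type v} (η : F ⟶ G) [IsIso η] :
    IsLocallyBijective J η := ⟨inferInstance, inferInstance⟩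

lemma IsLocallyBijective.comp {F G H : Cᵒᵖ ⥤ Type v} {η : F ⟶ G} {θ : G ⟶ H}
    (hη : IsLocallyBijective J η) (hθ : IsLocallyBijective J θ) : IsLocallyBijective J (η ≫ θ) :=
  have := hη.inj
  have := hη.surj
  have := hθ.inj
  have := hθ.surj
  ⟨inferInstance, inferInstance⟩

/-- A morphism to a separated presheaf identifies sections identified by a locally injective
morphism. -/
lemma app_eq_of_isLocallyInjective {F G H : Cᵒᵖ ⥤ Type v} {η : F ⟶ G}
    (hη : Presheaf.IsLocallyInjective J η) (hH : Presieve.IsSheaf J H) (g : F ⟶ H) {T : C}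
    {s t : F.obj (op T)} (h : η.app _ s = η.app _ t) : g.app _ s = g.app _ t := by
  refine (hH _ (Presheaf.equalizerSieve_mem J η s t h)).isSeparatedFor.ext fun T' f hf => ?_
  rw [← NatTrans.naturality_apply, ← NatTrans.naturality_apply]
  exact congrArg _ hf

/-- Locally bijective morphisms are orthogonal to sheaves. -/
theorem IsLocallyBijective.existsUnique_extension {F G H : Cᵒᵖ ⥤ Type v} {η : F ⟶ G}
    (hη : IsLocallyBijective J η) (hH : Presieve.IsSheaf J H) (g : F ⟶ H) :
    ∃! f : G ⟶ H, η ≫ f = g := by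
  have hsurj := hη.surj
  -- The value at `x` is characterized by all local preimages of `x`, not only the chosen ones, so
  -- that naturality follows from uniqueness.
  have key : ∀ {T : C} (x : G.obj (op T)), ∃! y : H.obj (op T), ∀ ⦃T' : C⦄ (f : T' ⟶ T)
      (s : F.obj (op T')), η.app _ s = G.map f.op x → H.map f.op y = g.app _ s := by
    intro T x
    have hS := Presheaf.imageSieve_mem J η x
    have hsh := hH _ hS
    let fam : Presieve.FamilyOfElements H (Presheaf.imageSieve η x).arrows :=
      fun T' f hf => g.app _ hf.choose
    have hfam : fam.Compatible := by
      intro Y₁ Y₂ Z g₁ g₂ f₁ f₂ h₁ h₂ e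
      dsimp only [fam]
      rw [← NatTrans.naturality_apply, ← NatTrans.naturality_apply]
      refine app_eq_of_isLocallyInjective hη.inj hH g ?_
      rw [NatTrans.naturality_apply, NatTrans.naturality_apply, h₁.choose_spec, h₂.choose_spec,
        ← ConcreteCategory.comp_apply, ← ConcreteCategory.comp_apply, ← G.map_comp, ← G.map_comp,
        ← op_comp, ← op_comp, e]
    refine ⟨hsh.amalgamate fam hfam, fun T' f s hs => ?_, fun y hy => ?_⟩
    · refine (hH _ (J.pullback_stable f hS)).isSeparatedFor.ext fun T'' k hk => ?_
      rw [← ConcreteCategory.comp_apply, ← H.map_comp, ← op_comp, hsh.valid_glue hfam _ hk,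
        ← NatTrans.naturality_apply]
      refine app_eq_of_isLocallyInjective hη.inj hH g ?_
      rw [NatTrans.naturality_apply, hs, hk.choose_spec, ← ConcreteCategory.comp_apply,
        ← G.map_comp, ← op_comp]
    · refine hsh.isSeparatedFor.ext fun T' f hf => ?_
      rw [hsh.valid_glue hfam _ hf]
      exact hy f _ hf.choose_spec
  choose y hy hu using @key
  have hspec : ∀ {T : C} (s : F.obj (op T)), y (η.app _ s) = g.app _ s := by
    intro T s
    refine (hu _ _ fun T' f t ht => ?_).symm
    rw [← NatTrans.naturality_apply]
    refine app_eq_of_isLocallyInjective hη.inj hH g ?_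
    rw [NatTrans.naturality_apply, ht]
  refine ⟨{ app := fun T => ↾fun x => y (T := T.unop) x, naturality := ?_ }, ?_, ?_⟩
  · intro S T k
    ext x
    refine (hu _ _ fun T' f t ht => ?_).symm
    change H.map f.op (H.map k (y x)) = _
    have := hy x (f ≫ k.unop) t (by
      rw [ht, op_comp, G.map_comp, ConcreteCategory.comp_apply, Quiver.Hom.op_unop]
      rfl)
    rw [← this, op_comp, H.map_comp, ConcreteCategory.comp_apply, Quiver.Hom.op_unop]
  · ext T s
    exact hspec s
  · intro f hf
    ext T x
    refine hu (T := T.unop) x _ fun T' k s hs => ?_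
    refine (NatTrans.naturality_apply f k.op x).symm.trans ?_
    rw [← hf]
    exact congrArg _ hs.symm

lemma IsLocallyBijective.isReflecting [J.Subcanonical] {F : Cᵒᵖ ⥤ Type v} {X : C}
    {η : F ⟶ yoneda.obj X} (hη : IsLocallyBijective J η) : IsReflecting η := by
  intro Y g
  obtain ⟨f, hf, hu⟩ := hη.existsUnique_extension
    (GrothendieckTopology.Subcanonical.isSheaf_of_isRepresentable (yoneda.obj Y)) g
  refine ⟨yoneda.preimage f, by simpa using hf, fun f' hf' => yoneda.map_injective ?_⟩
  rw [yoneda.map_preimage]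
  exact hu _ hf'

/-- The source of the restriction to finite limits: a common refinement of covers exists for finite
families. -/
lemma exists_covering_le_of_finite {ι : Type*} [Finite ι] {T : C} (S : ι → Sieve T)
    (hS : ∀ i, S i ∈ J T) : ∃ R ∈ J T, ∀ i, R ≤ S i := by
  have := Fintype.ofFinite ι
  refine ⟨Finset.univ.inf S, Finset.inf_induction (p := (· ∈ J T)) (J.top_mem T)
    (fun _ h _ h' => J.intersection_covering h h') (fun i _ => hS i),
    fun i => Finset.inf_le (Finset.mem_univ i)⟩

section Limit

variable {K : Type} [SmallCategory K] {F X : K ⥤ Cᵒᵖ ⥤ Type v} {c : Cone F}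
  {d : Cone X}

lemma cone_naturality (c : Cone F) (k : K) {T T' : C} (f : T' ⟶ T) (s : c.pt.obj (op T)) :
    (c.π.app k).app _ (c.pt.map f.op s) = (F.obj k).map f.op ((c.π.app k).app _ s) :=
  NatTrans.naturality_apply (c.π.app k) f.op s

lemma limit_section_ext (hc : IsLimit c) {T : C} {s t : c.pt.obj (op T)}
    (h : ∀ k, (c.π.app k).app _ s = (c.π.app k).app _ t) : s = t :=
  Concrete.isLimit_ext _ (isLimitOfPreserves ((evaluation _ _).obj (op T)) hc) s t h

lemma limit_section_exists (hc : IsLimit c) {T : C} (s : ∀ k, (F.obj k).obj (op T))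
    (h : ∀ {k l} (f : k ⟶ l), (F.map f).app _ (s k) = s l) :
    ∃ t : c.pt.obj (op T), ∀ k, (c.π.app k).app _ t = s k := by
  let e := Types.isLimitEquivSections (isLimitOfPreserves ((evaluation _ _).obj (op T)) hc)
  refine ⟨e.symm ⟨s, fun f => h f⟩, fun k => ?_⟩
  have := e.apply_symm_apply ⟨s, fun f => h f⟩
  exact congrFun (congrArg Subtype.val this) k

/-- Finite limits of locally bijective morphisms are locally bijective. -/
theorem IsLocallyBijective.limit [FinCategory K] (hc : IsLimit c) (hd : IsLimit d) (τ : F ⟶ X)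
    (hτ : ∀ k, IsLocallyBijective J (τ.app k)) {η : c.pt ⟶ d.pt}
    (hη : ∀ k, η ≫ d.π.app k = c.π.app k ≫ τ.app k) : IsLocallyBijective J η := by
  have hη' : ∀ k {T : C} (s : c.pt.obj (op T)),
      (d.π.app k).app _ (η.app _ s) = (τ.app k).app _ ((c.π.app k).app _ s) := fun k T s =>
    ConcreteCategory.congr_hom (NatTrans.congr_app (hη k) (op T)) s
  constructor
  · refine ⟨fun {T} s t h => ?_⟩
    obtain ⟨T⟩ := T
    have hk : ∀ k, (τ.app k).app _ ((c.π.app k).app _ s) = (τ.app k).app _ ((c.π.app k).app _ t) :=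
      fun k => by rw [← hη', ← hη', h]
    obtain ⟨R, hR, hRk⟩ := exists_covering_le_of_finite _
      fun k => (hτ k).inj.equalizerSieve_mem _ _ (hk k)
    refine J.superset_covering (fun T' f hf => limit_section_ext hc fun k => ?_) hR
    have := hRk k f hf
    rw [Presheaf.equalizerSieve_apply] at this
    rw [cone_naturality, cone_naturality]
    exact this
  · refine ⟨fun {T} x => ?_⟩
    obtain ⟨R, hR, hRk⟩ := exists_covering_le_of_finite _
      fun k => (hτ k).surj.imageSieve_mem ((d.π.app k).app _ x)
    refine J.transitive hR _ fun T' f hf => ?_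
    choose s hs using fun k => hRk k f hf
    have hX : ∀ {k l} (u : k ⟶ l) {T : C} (y : d.pt.obj (op T)),
        (X.map u).app _ ((d.π.app k).app _ y) = (d.π.app l).app _ y := fun u T y =>
      ConcreteCategory.congr_hom (NatTrans.congr_app (d.w u) (op T)) y
    have hτ' : ∀ {k l} (u : k ⟶ l) {T : C} (y : (F.obj k).obj (op T)),
        (τ.app l).app _ ((F.map u).app _ y) = (X.map u).app _ ((τ.app k).app _ y) := fun u T y =>
      ConcreteCategory.congr_hom (NatTrans.congr_app (τ.naturality u) (op T)) y
    -- The local preimages `s k` are compatible only after applying `τ`. Local injectivity, on one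
    -- further cover handling the finitely many arrows at once, makes them a section of the limit.
    have hu : ∀ a : (Σ k l : K, k ⟶ l), (τ.app a.2.1).app _ ((F.map a.2.2).app _ (s a.1)) =
        (τ.app a.2.1).app _ (s a.2.1) := by
      rintro ⟨k, l, u⟩
      rw [hτ', hs, hs, NatTrans.naturality_apply, hX]
    obtain ⟨R', hR', hRa⟩ := exists_covering_le_of_finite _
      fun a => (hτ _).inj.equalizerSieve_mem _ _ (hu a)
    refine J.superset_covering (fun T'' g hg => ?_) hR'
    obtain ⟨t, ht⟩ := limit_section_exists hc (fun k => (F.obj k).map g.op (s k)) (by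
      intro k l u
      have := hRa ⟨k, l, u⟩ g hg
      rw [Presheaf.equalizerSieve_apply] at this
      rw [NatTrans.naturality_apply]
      exact this)
    refine ⟨t, limit_section_ext hd fun k => ?_⟩
    rw [hη', ht, NatTrans.naturality_apply, hs, cone_naturality, op_comp, Functor.map_comp,
      ConcreteCategory.comp_apply]

end Limit

end LocallyBijective

/-! ### Covering sieves of the canonical topology. -/

section CanonicalCovers

variable {C : Type u} [Category.{v} C]

/-- Every object over `T` is initial by strictness, so each representable has exactly one section
there. -/
lemma bot_mem_canonicalTopology [HasInitial C] [HasStrictInitialObjects C] {T : C} (t : T ⟶ ⊥_ C) :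
    (⊥ : Sieve T) ∈ Sheaf.canonicalTopology C T := by
  refine Sheaf.mem_finestTopology_of_forall_isSheafFor ?_
  rintro _ ⟨Z, rfl⟩ Y f x -
  have := HasStrictInitialObjects.out (f ≫ t) initialIsInitial
  have hY : IsInitial Y := initialIsInitial.ofIso (asIso (f ≫ t)).symm
  exact ⟨hY.to Z, fun _ _ h => h.elim, fun _ _ => hY.hom_ext _ _⟩

/-- The sieve generated by two morphisms. -/
def pairSieve {A B U : C} (i : A ⟶ U) (j : B ⟶ U) : Sieve U where
  arrows _ f := (∃ x, x ≫ i = f) ∨ (∃ x, x ≫ j = f)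
  downward_closed := by
    rintro _ _ _ (⟨x, rfl⟩ | ⟨x, rfl⟩) g
    · exact Or.inl ⟨g ≫ x, Category.assoc _ _ _⟩
    · exact Or.inr ⟨g ≫ x, Category.assoc _ _ _⟩

/-- After pullback along any `f`, a compatible family is determined by its values on the legs of the
pulled-back pushout; these agree on `P'`, so they glue uniquely. -/
lemma IsStablePushout.pairSieve_mem_canonicalTopology [HasPullbacks C] {P A B U : C} {p : P ⟶ A}
    {q : P ⟶ B} {i : A ⟶ U} {j : B ⟶ U} (H : IsStablePushout p q i j) :
    pairSieve i j ∈ Sheaf.canonicalTopology C U := by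
  refine Sheaf.mem_finestTopology_of_forall_isSheafFor ?_
  rintro _ ⟨Z, rfl⟩ Y f x hx
  obtain ⟨P', A', B', p', q', i', j', hA, hB, h1, h2, h3⟩ := H.exists_pullback f
  have mi : ((pairSieve i j).pullback f) i' := Or.inl ⟨hA, h1.w.symm⟩
  have mj : ((pairSieve i j).pullback f) j' := Or.inr ⟨hB, h2.w.symm⟩
  refine ⟨h3.1.desc (x i' mi) (x j' mj) (hx p' q' mi mj h3.1.w), ?_, ?_⟩
  · rintro T g (⟨y, hy⟩ | ⟨y, hy⟩)
    · have e := h1.lift_fst _ _ hy.symm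
      have := hx (h1.lift g y hy.symm) (𝟙 T) mi (Or.inl ⟨y, hy⟩) (by simp)
      change g ≫ _ = _
      conv_lhs => rw [← e]
      rw [Category.assoc, h3.1.inl_desc]
      exact this.trans (Category.id_comp _)
    · have e := h2.lift_fst _ _ hy.symm
      have := hx (h2.lift g y hy.symm) (𝟙 T) mj (Or.inr ⟨y, hy⟩) (by simp)
      change g ≫ _ = _
      conv_lhs => rw [← e]
      rw [Category.assoc, h3.1.inr_desc]
      exact this.trans (Category.id_comp _)
  · intro t ht
    refine h3.1.hom_ext ?_ ?_
    · rw [h3.1.inl_desc]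
      exact ht i' mi
    · rw [h3.1.inr_desc]
      exact ht j' mj

end CanonicalCovers

/-! ### Local reflections of the presheaves in the completion. -/

section LocalReflection

variable {C : Type u} [Category.{v} C] (J : GrothendieckTopology C)

/-- A presheaf which is locally isomorphic to a representable one. -/
def HasLocalReflection (F : Cᵒᵖ ⥤ Type v) : Prop :=
  ∃ (X : C) (η : F ⟶ yoneda.obj X), IsLocallyBijective J η

variable {J}

lemma HasLocalReflection.of_iso {F G : Cᵒᵖ ⥤ Type v} (e : F ≅ G) (hF : HasLocalReflection J F) :
    HasLocalReflection J G :=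
  let ⟨X, η, hη⟩ := hF
  ⟨X, e.inv ≫ η, (isLocallyBijective_of_isIso e.inv).comp hη⟩

/-- Uniqueness of reflections turns the objects `X k` into a diagram in `C`, and Yoneda preserves
its limit. -/
lemma HasLocalReflection.finiteLimit [J.Subcanonical] [HasFiniteLimits C] {K : Type}
    [SmallCategory K] [FinCategory K] {F : K ⥤ Cᵒᵖ ⥤ Type v}
    (hF : ∀ k, HasLocalReflection J (F.obj k)) {c : Cone F} (hc : IsLimit c) :
    HasLocalReflection J c.pt := by
  choose X η hη using hF
  choose m hm hu using fun (k l : K) (f : k ⟶ l) => (hη k).isReflecting _ (F.map f ≫ η l)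
  beta_reduce at hm hu
  let X' : K ⥤ C :=
    { obj := X
      map := fun f => m _ _ f
      map_id := fun k => (hu k k (𝟙 k) _ (by simp)).symm
      map_comp := fun {k l n} f g => (hu k n (f ≫ g) _ (by
        rw [yoneda.map_comp, ← Category.assoc, hm, Category.assoc, hm, F.map_comp,
          Category.assoc])).symm }
  let τ : F ⟶ X' ⋙ yoneda :=
    { app := η
      naturality := fun k l f => (hm k l f).symm }
  have hd := isLimitOfPreserves yoneda (limit.isLimit X')
  refine ⟨limit X', hd.lift ⟨c.pt, c.π ≫ τ⟩, IsLocallyBijective.limit hc hd τ hη fun k => ?_⟩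
  exact hd.fac _ k

/-- The morphism of reflections induced by a monomorphism of presheaves is a monomorphism. -/
lemma mono_of_isLocallyBijective [J.Subcanonical] {F G : Cᵒᵖ ⥤ Type v} {X Y : C}
    {η : F ⟶ yoneda.obj X} {θ : G ⟶ yoneda.obj Y} (hη : IsLocallyBijective J η)
    (hθ : IsLocallyBijective J θ) {a : F ⟶ G} [Mono a] {m : X ⟶ Y}
    (h : η ≫ yoneda.map m = a ≫ θ) : Mono m := by
  refine ⟨fun {T} s t hst => ?_⟩
  have hX : Presieve.IsSheaf J (yoneda.obj X) :=
    GrothendieckTopology.Subcanonical.isSheaf_of_isRepresentable _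
  have h1 : Presheaf.imageSieve η (U := T) s ⊓ Presheaf.imageSieve η (U := T) t ∈ J T :=
    J.intersection_covering (hη.surj.imageSieve_mem (U := T) s) (hη.surj.imageSieve_mem (U := T) t)
  refine (hX _ h1).isSeparatedFor.ext ?_
  rintro T' f ⟨⟨x, hx⟩, ⟨y, hy⟩⟩
  rw [← hx, ← hy]
  have ha : ∀ z : F.obj (op T'), θ.app _ (a.app _ z) = (yoneda.map m).app _ (η.app _ z) :=
    fun z => (ConcreteCategory.congr_hom (NatTrans.congr_app h (op T')) z).symm
  have hxy : θ.app _ (a.app _ x) = θ.app _ (a.app _ y) := by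
    rw [ha, ha, hx, hy]
    change (f ≫ s) ≫ m = (f ≫ t) ≫ m
    rw [Category.assoc, Category.assoc, hst]
  -- Local lifts of `s` and `t` have images in `G` that agree locally, and `a` is injective on
  -- sections.
  refine (hX _ (hθ.inj.equalizerSieve_mem _ _ hxy)).isSeparatedFor.ext fun T'' g hg => ?_
  rw [← NatTrans.naturality_apply, ← NatTrans.naturality_apply]
  congr 1
  have hinj : Function.Injective (a.app (op T'')) := (mono_iff_injective _).1 inferInstance
  apply hinj
  rw [NatTrans.naturality_apply, NatTrans.naturality_apply]
  exact hg

lemma HasLocalReflection.empty [HasInitial C] (hJ : ∀ {T : C} (_ : T ⟶ ⊥_ C), ⊥ ∈ J T) :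
    HasLocalReflection J (emptyPresheaf C) := by
  refine ⟨⊥_ C, emptyPresheafIsInitial.to _, ⟨fun x => x.elim⟩, ⟨fun {T} s => ?_⟩⟩
  exact J.superset_covering bot_le (hJ s)

/-- The reflection is the stable pushout of the reflected subobjects. Injectivity is inherited from
`ηX` on the ambient presheaf; surjectivity holds because the two legs cover `U` and `ηA`, `ηB` are
locally surjective. -/
lemma HasLocalReflection.union [J.Subcanonical] [HasFiniteLimits C]
    (h : HasStablePushoutsOfMonoPullbacks C)
    (hJ : ∀ {P A B U : C} {p : P ⟶ A} {q : P ⟶ B} {i : A ⟶ U} {j : B ⟶ U},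
      IsStablePushout p q i j → pairSieve i j ∈ J U)
    {P A B X : Cᵒᵖ ⥤ Type v} {p : P ⟶ A} {q : P ⟶ B} {a : A ⟶ X} {b : B ⟶ X} [Mono a] [Mono b]
    (hP : IsPullback p q a b)
    (hA : HasLocalReflection J A) (hB : HasLocalReflection J B) (hX : HasLocalReflection J X) :
    HasLocalReflection J (unionRange a b).toFunctor := by
  obtain ⟨A', ηA, hA⟩ := hA
  obtain ⟨B', ηB, hB⟩ := hB
  obtain ⟨X', ηX, hX⟩ := hX
  obtain ⟨a', ha', -⟩ := hA.isReflecting _ (a ≫ ηX)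
  obtain ⟨b', hb', -⟩ := hB.isReflecting _ (b ≫ ηX)
  have := mono_of_isLocallyBijective hA hX ha'
  have := mono_of_isLocallyBijective hB hX hb'
  have hP' := IsPullback.of_hasPullback a' b'
  obtain ⟨U, i, j, H⟩ := h _ _ _ _ hP'
  obtain ⟨m, hi, hj⟩ := H.1.exists_desc a' b' hP'.w
  have := H.mono_of_isPullback hP' hi hj
  have hpo := isPushout_unionRange hP
  obtain ⟨θ, hθA, hθB⟩ := hpo.exists_desc (ηA ≫ yoneda.map i) (ηB ≫ yoneda.map j) (by
    -- Comparing inside `X'` avoids relating `P` to the intersection of `A'` and `B'`.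
    rw [← cancel_mono (yoneda.map m)]
    simp only [Category.assoc, ← yoneda.map_comp, hi, hj, ha', hb', hP.w_assoc])
  have hθ : θ ≫ yoneda.map m = (unionRange a b).ι ≫ ηX := by
    refine hpo.hom_ext ?_ ?_
    · rw [← Category.assoc, hθA, Category.assoc, ← yoneda.map_comp, hi, ha']
      rfl
    · rw [← Category.assoc, hθB, Category.assoc, ← yoneda.map_comp, hj, hb']
      rfl
  refine ⟨U, θ, ⟨fun {T} s t hst => ?_⟩, ⟨fun {T} x => ?_⟩⟩
  · have hθ' : ∀ z : (unionRange a b).toFunctor.obj T,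
        ηX.app _ z.1 = (yoneda.map m).app _ (θ.app _ z) :=
      fun z => (ConcreteCategory.congr_hom (NatTrans.congr_app hθ T) z).symm
    refine J.superset_covering ?_
      (hX.inj.equalizerSieve_mem s.1 t.1 (by rw [hθ', hθ', hst]))
    intro T' f hf
    exact Subtype.ext hf
  · refine J.transitive (J.pullback_stable x (hJ H)) _ ?_
    rintro T' f (⟨y, hy⟩ | ⟨y, hy⟩)
    · refine J.superset_covering ?_ (hA.surj.imageSieve_mem (U := T') y)
      rintro T'' g ⟨s, hs⟩
      refine ⟨(unionInl a b).app _ s, ?_⟩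
      refine (ConcreteCategory.congr_hom (NatTrans.congr_app hθA (op T'')) s).trans ?_
      change (ηA.app _ s : T'' ⟶ A') ≫ i = (g ≫ f) ≫ x
      rw [hs, Category.assoc, ← hy]
      exact Category.assoc _ _ _
    · refine J.superset_covering ?_ (hB.surj.imageSieve_mem (U := T') y)
      rintro T'' g ⟨s, hs⟩
      refine ⟨(unionInr a b).app _ s, ?_⟩
      refine (ConcreteCategory.congr_hom (NatTrans.congr_app hθB (op T'')) s).trans ?_
      change (ηB.app _ s : T'' ⟶ B') ≫ j = (g ≫ f) ≫ x
      rw [hs, Category.assoc, ← hy]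
      exact Category.assoc _ _ _

theorem InLexCompletion.hasLocalReflection [J.Subcanonical] [HasFiniteLimits C] [HasInitial C]
    (h : HasStablePushoutsOfMonoPullbacks C) (hJ0 : ∀ {T : C} (_ : T ⟶ ⊥_ C), ⊥ ∈ J T)
    (hJ : ∀ {P A B U : C} {p : P ⟶ A} {q : P ⟶ B} {i : A ⟶ U} {j : B ⟶ U},
      IsStablePushout p q i j → pairSieve i j ∈ J U)
    {F : Cᵒᵖ ⥤ Type v} (hF : InLexCompletion finiteUnionWeights.{v} C F) :
    HasLocalReflection J F := by
  induction hF with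
  | representable X => exact ⟨X, 𝟙 _, isLocallyBijective_of_isIso _⟩
  | iso e _ ih => exact ih.of_iso e
  | finiteLimit F _ c hc ih => exact HasLocalReflection.finiteLimit ih hc
  | lexColimit φ hφ D hD _ X c hc ih =>
    obtain rfl | rfl := hφ
    · let d : WeightedCocone emptyWeight.weight D (emptyPresheaf C) :=
        ⟨fun _ x => x.elim, fun _ x => x.elim⟩
      have hd : d.IsColimit := fun Y s => ⟨emptyPresheafIsInitial.to Y, fun k x => x.elim,
        fun f _ => emptyPresheafIsInitial.hom_ext _ _⟩
      obtain ⟨e⟩ := hd.nonempty_iso hc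
      exact (HasLocalReflection.empty hJ0).of_iso e
    · let D' : MonoPair.{v} ⥤ Cᵒᵖ ⥤ Type v := D
      have : PreservesFiniteLimits D' := hD
      obtain ⟨e⟩ := (unionCocone_isColimit D').nonempty_iso hc
      exact (HasLocalReflection.union h hJ (MonoPair.isPullback_gen.{v}.map D') (ih _) (ih _)
        (ih _)).of_iso e

end LocalReflection

/-! ### The left exact reflector. -/

section MainResult

variable {C : Type u} [Category.{v} C] [HasFiniteLimits C]

instance (Φ : Set LexWeight.{v}) (K : Type) [SmallCategory K] [FinCategory K] :
    (lexCompletion Φ C).IsClosedUnderLimitsOfShape K where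
  limitsOfShape_le := by
    rintro F ⟨p⟩
    exact InLexCompletion.finiteLimit p.diag p.prop_diag_obj _ p.isLimit

/-- Local reflections for a subcanonical topology yield exactness. -/
theorem isLexExact_of_hasLocalReflection (J : GrothendieckTopology C) [J.Subcanonical]
    (Φ : Set LexWeight.{v})
    (h : ∀ F : Cᵒᵖ ⥤ Type v, InLexCompletion Φ C F → HasLocalReflection J F) :
    IsLexExact Φ C := by
  choose R η hη using fun F : (lexCompletion Φ C).FullSubcategory => h F.obj F.property
  let W := lexCompletionUnit Φ C
  let e : ∀ (F : (lexCompletion Φ C).FullSubcategory) (Y : C), (R F ⟶ Y) ≃ (F ⟶ W.obj Y) :=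
    fun F Y => Equiv.ofBijective (fun f => ObjectProperty.homMk (η F ≫ yoneda.map f)) (by
      rw [Function.bijective_iff_existsUnique]
      intro g
      obtain ⟨f, hf, hu⟩ := (hη F).isReflecting Y g.hom
      exact ⟨f, ObjectProperty.hom_ext _ hf, fun f' hf' => hu f' (congrArg (fun m => m.hom) hf')⟩)
  have he : ∀ F Y Y' (g : Y ⟶ Y') (f : R F ⟶ Y), e F Y' (f ≫ g) = e F Y f ≫ W.map g := by
    intro F Y Y' g f
    refine ObjectProperty.hom_ext _ ?_
    change η F ≫ yoneda.map (f ≫ g) = (η F ≫ yoneda.map f) ≫ yoneda.map g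
    rw [yoneda.map_comp, Category.assoc]
  refine ⟨_, ⟨Adjunction.adjunctionOfEquivLeft e he⟩, ⟨fun K _ _ => ⟨fun {F} => ⟨fun {c} hc => ?_⟩⟩⟩⟩
  let L := Adjunction.leftAdjointOfEquiv e he
  have hL : ∀ {F G : (lexCompletion Φ C).FullSubcategory} (t : F ⟶ G),
      η F ≫ yoneda.map (L.map t) = t.hom ≫ η G := by
    intro F G t
    have : e F (R G) (L.map t) = t ≫ e G (R G) (𝟙 _) := Equiv.apply_symm_apply _ _
    have := congrArg (fun m => m.hom) this
    refine this.trans ?_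
    change t.hom ≫ η G ≫ yoneda.map (𝟙 _) = _
    rw [yoneda.map_id, Category.comp_id]
  -- The completion is closed under finite limits, so these are computed in presheaves.
  have hι : IsLimit ((lexCompletion Φ C).ι.mapCone c) := isLimitOfPreserves _ hc
  let τ : F ⋙ (lexCompletion Φ C).ι ⟶ (F ⋙ L) ⋙ yoneda :=
    { app := fun k => η (F.obj k)
      naturality := fun k l f => (hL (F.map f)).symm }
  have hd := isLimitOfPreserves yoneda (limit.isLimit (F ⋙ L))
  let m : L.obj c.pt ⟶ limit (F ⋙ L) := limit.lift (F ⋙ L) (L.mapCone c)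
  have hm : IsLocallyBijective J (η c.pt ≫ yoneda.map m) := by
    refine IsLocallyBijective.limit hι hd τ (fun k => hη _) fun k => ?_
    change (η c.pt ≫ yoneda.map m) ≫ yoneda.map (limit.π (F ⋙ L) k) = _
    rw [Category.assoc, ← yoneda.map_comp, limit.lift_π]
    exact hL (c.π.app k)
  -- Both `η c.pt` and `η c.pt ≫ yoneda.map m` are reflecting, and two reflections of one presheaf
  -- differ by an isomorphism.
  have hiso : IsIso m := by
    obtain ⟨n, hn, -⟩ := hm.isReflecting _ (η c.pt)
    refine ⟨n, ?_, ?_⟩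
    · refine ((hη c.pt).isReflecting _ (η c.pt)).unique ?_
        ((congrArg _ (yoneda.map_id _)).trans (Category.comp_id _))
      rw [yoneda.map_comp, ← Category.assoc, hn]
    · refine (hm.isReflecting _ (η c.pt ≫ yoneda.map m)).unique ?_
        ((congrArg _ (yoneda.map_id _)).trans (Category.comp_id _))
      rw [yoneda.map_comp, ← Category.assoc, hn]
  exact ⟨IsLimit.ofIsoLimit (limit.isLimit (F ⋙ L)) (Cone.ext (asIso m) fun k =>
    (limit.lift_π (L.mapCone c) k).symm).symm⟩

/-- Stable pushouts of intersections and a strict initial object yield finite-union exactness. -/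
theorem isLexExact_of_hasStablePushouts [HasInitial C] [HasStrictInitialObjects C]
    (h : HasStablePushoutsOfMonoPullbacks C) : IsLexExact finiteUnionWeights.{v} C :=
  isLexExact_of_hasLocalReflection (Sheaf.canonicalTopology C) _ fun _ hF =>
    hF.hasLocalReflection h bot_mem_canonicalTopology
      IsStablePushout.pairSieve_mem_canonicalTopology

end MainResult

end LexColim

theorem mainTheorem8 {C : Type u} [Category.{v} C] [HasFiniteLimits C] :
    List.TFAE
      [LexColim.IsLexExact LexColim.finiteUnionWeights.{v} C,
       HasInitial C ∧ HasStrictInitialObjects C ∧ LexColim.HasStablePushoutsOfMonoPullbacks C,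
       LexColim.HasStableEffectiveFiniteUnions C] := by
  tfae_have 1 → 2 := fun h =>
    ⟨h.exists_strict_initial.1, h.exists_strict_initial.2, h.hasStablePushouts⟩
  tfae_have 2 → 1 := fun ⟨_, _, h⟩ => LexColim.isLexExact_of_hasStablePushouts h
  tfae_have 2 → 3 := fun ⟨_, _, h⟩ => LexColim.hasStableEffectiveFiniteUnions_of_pushouts h
  tfae_have 3 → 2 := fun h =>
    ⟨h.exists_strict_initial.1, h.exists_strict_initial.2, h.hasStablePushouts⟩
  tfae_finish
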